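/- Let $\Omega$ be a Polish space, $\nu$ a finite Borel measure on $\Omega$, $\phi_1,\dots,\phi_p\in L^2(\Omega,\nu)$ real functions whose Gramian $G=\big(\int\phi_i\phi_j\,d\nu\big)_{i,j}$ is non-singular, and $\Lambda$ a $p\times p$ positive semi-definite symmetric matrix. For $x\in\Omega^n$ put $\phi(x)=(\phi_j(x_i))\in\mathbb R^{n\times p}$, and let $\mathrm{PVS}(\nu,\phi,\Lambda)$ be the point process (a law on finite multisets of points of $\Omega$) whose Janossy densities with respect to $\nu^{\otimes n}$ are $$j_n(x)=\frac{\det(\phi(x)^T\phi(x)+\Lambda)}{\det(G+\Lambda)\,e^{\nu(\Omega)}},\qquad n\ge 0 .$$ Let $G^{1/2}(G+\Lambda)^{-1}G^{1/2}=PDP^T$ be a spectral decomposition, with $P$ orthogonal and $D=\mathrm{diag}(\lambda_1,\dots,\lambda_p)$, and let $(\psi_1,\dots,\psi_p)=(\phi_1,\dots,\phi_p)\,G^{-1/2}P$. For $w\in[0,1]^p$ let $K_w(x,y)=\sum_i w_i\psi_i(x)\psi_i(y)$; a DPP with kernel $K$ and reference measure $\nu$ is a point process whose $n$-th correlation function with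 respect to $\nu^{\otimes n}$ is $\det(K(x_i,x_j))_{i,j\le n}$ for every $n$. Then: 1. $\lambda_i\in[0,1]$ for all $i$, the $\psi_i$ are orthonormal in $L^2(\nu)$, and for every $w\in[0,1]^p$ there is exactly one law of a DPP with kernel $K_w$ and reference measure $\nu$. 2. If $X$ is a DPP with kernel $K_\lambda(x,y)=\sum_i\lambda_i\psi_i(x)\psi_i(y)$ and reference measure $\nu$, and $Y$ is an independent Poisson point process with intensity $\nu$, then the superposition (multiset union, adding multiplicities) of $X$ and $Y$ has law $\mathrm{PVS}(\nu,\phi,\Lambda)$. 3. Let $k\in\mathbb N$ be such that $\mathrm{PVS}(\nu,\phi,\Lambda)$ has exactly $k$ points with positive probability; this is so for every $k\ge p$ if $\nu\ne0$. Draw independent $I_i\sim\mathrm{Ber}(\lambda_i)$, $1\le i\le p$, and $N\sim\mathrm{Poisson}(\nu(\Omega))$, conditioned on $N+\sum_i I_i=k$; given these, draw independently a DPP with kernel $\sum_i I_i\psi_i(x)\psi_i(y)$ and reference measure $\nu$, and $N$ i.i.d. points with distribution $\nu/\nu(\Omega)$. The superposition of the two has the law of $\mathrm{PVS}(\nu,\phi,\Lambda)$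 conditioned on having $k$ points. -/

import Mathlib

open MeasureTheory ProbabilityTheory
open scoped ENNReal NNReal MatrixOrder Matrix

noncomputable section

namespace PVS

/-! ### Finite point configurations

A finite point configuration in `Ω` is a multiset of points of `Ω` (points may be repeated), and the
superposition of two configurations is the sum of multisets, which adds the multiplicities. -/

section Configurations

variable {Ω : Type*}

open Classical in
/-- The number of points of the configuration `s` in the set `B`, counted with multiplicity. -/
def count (B : Set Ω) (s : Multiset Ω) : ℕ := s.countP (fun x => x ∈ B)

/-- The configuration of the points of a tuple. -/
def config {n : ℕ} (x : Fin n → Ω) : Multiset Ω := Finset.univ.val.map x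

/-- The usual σ-algebra on finite point configurations: the smallest one for which the number of
points in each measurable set is measurable. -/
instance instMeasurableSpaceMultiset [MeasurableSpace Ω] : MeasurableSpace (Multiset Ω) :=
  ⨆ (B : Set Ω) (_ : MeasurableSet B), MeasurableSpace.comap (count B) ⊤

lemma measurable_count [MeasurableSpace Ω] {B : Set Ω} (hB : MeasurableSet B) :
    Measurable (count B) :=
  fun t ht => (le_iSup₂_of_le (f := fun (B : Set Ω) (_ : MeasurableSet B) =>
    MeasurableSpace.comap (count B) ⊤) B hB le_rfl) _ ⟨t, ht, rfl⟩

/-- The sum of `f (x₁, …, xₙ)` over all `n`-tuples of points of the configuration `s` with pairwise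
distinct labels (a point of multiplicity `m` counts as `m` points with distinct labels). -/
def sumDistinct {n : ℕ} (f : (Fin n → Ω) → ℝ≥0∞) (s : Multiset Ω) : ℝ≥0∞ :=
  ∑ e : Fin n ↪ Fin s.toList.length, f (fun i => s.toList.get (e i))

end Configurations

section PointProcesses

variable {Ω : Type*} [MeasurableSpace Ω]

/-- The law of the finite point process with Janossy densities `j n` with respect to the powers
of `ν`: it has `n` points, lying at `dx₁, …, dxₙ`, with
"probability" `(1 / n!) j n x dν(x₁) ⋯ dν(xₙ)`. -/
def janossyLaw (ν : Measure Ω) (j : (n : ℕ) → (Fin n → Ω) → ℝ) : Measure (Multiset Ω) :=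
  Measure.sum fun n : ℕ => ((n.factorial : ℝ≥0∞)⁻¹) •
    ((Measure.pi fun _ : Fin n => ν).withDensity fun x => ENNReal.ofReal (j n x)).map config

/-- `ρ n` is the `n`-th correlation function, with respect to the powers of `ν`, of the point
process with law `μ`, for all `n`. -/
def HasCorrelationFunctions (ν : Measure Ω) (ρ : (n : ℕ) → (Fin n → Ω) → ℝ)
    (μ : Measure (Multiset Ω)) : Prop :=
  ∀ (n : ℕ) (f : (Fin n → Ω) → ℝ≥0∞), Measurable f →
    ∫⁻ s, sumDistinct f s ∂μ =
      ∫⁻ x, f x * ENNReal.ofReal (ρ n x) ∂(Measure.pi fun _ : Fin n => ν)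

/-- `μ` is the law of a determinantal point process with kernel `K` and reference measure `ν`. -/
structure IsDPP (ν : Measure Ω) (K : Ω → Ω → ℝ) (μ : Measure (Multiset Ω)) : Prop where
  isProbabilityMeasure : IsProbabilityMeasure μ
  correlation : HasCorrelationFunctions ν
    (fun n x => Matrix.det (Matrix.of fun i j : Fin n => K (x i) (x j))) μ

/-- `μ` is the law of a Poisson point process with (finite) intensity measure `ν`: the number of
points in a measurable set `B` has the Poisson distribution with parameter `ν B`, and the numbers of
points in pairwise disjoint measurable sets are independent. -/
structure IsPoissonProcess (ν : Measure Ω) (μ : Measure (Multiset Ω)) : Prop where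
  isProbabilityMeasure : IsProbabilityMeasure μ
  count_law : ∀ B : Set Ω, MeasurableSet B → μ.map (count B) = poissonMeasure (ν B).toNNReal
  count_indep : ∀ (m : ℕ) (B : Fin m → Set Ω), (∀ i, MeasurableSet (B i)) →
    Pairwise (fun i j => Disjoint (B i) (B j)) → iIndepFun (fun i => count (B i)) μ

/-- The law of the configuration of `n` independent points with distribution `ν / ν(Ω)`. -/
def iidLaw (ν : Measure Ω) (n : ℕ) : Measure (Multiset Ω) :=
  (Measure.pi fun _ : Fin n => (ν Set.univ)⁻¹ • ν).map config

end PointProcesses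

section VolumeSampling

variable {Ω : Type*} [MeasurableSpace Ω] {p : ℕ}

/-- The Gramian matrix `G_ν(φ)`. -/
def gram (ν : Measure Ω) (φ : Fin p → Ω → ℝ) : Matrix (Fin p) (Fin p) ℝ :=
  Matrix.of fun i j => ∫ x, φ i x * φ j x ∂ν

/-- The symmetric square root `G_ν(φ)^{1/2}` of the Gramian matrix. -/
def gramSqrt (ν : Measure Ω) (φ : Fin p → Ω → ℝ) : Matrix (Fin p) (Fin p) ℝ :=
  CFC.sqrt (gram ν φ)

/-- The design matrix `φ(x)`, with entry `φ_j(x_i)` in row `i` and column `j`. -/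
def design (φ : Fin p → Ω → ℝ) {n : ℕ} (x : Fin n → Ω) : Matrix (Fin n) (Fin p) ℝ :=
  Matrix.of fun i j => φ j (x i)

/-- Proportional volume sampling with reference measure `ν`, features `φ` and regularization `Λ`. -/
def pvs (ν : Measure Ω) (φ : Fin p → Ω → ℝ) (Λ : Matrix (Fin p) (Fin p) ℝ) :
    Measure (Multiset Ω) :=
  janossyLaw ν fun _ x =>
    ((design φ x)ᵀ * design φ x + Λ).det / ((gram ν φ + Λ).det * Real.exp (ν.real Set.univ))

/-- The functions `(ψ₁, …, ψ_p) = (φ₁, …, φ_p) G_ν(φ)^{-1/2} P`. -/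
def orthoFeatures (ν : Measure Ω) (φ : Fin p → Ω → ℝ) (P : Matrix (Fin p) (Fin p) ℝ) :
    Fin p → Ω → ℝ :=
  fun i x => Matrix.vecMul (fun j => φ j x) ((gramSqrt ν φ)⁻¹ * P) i

/-- The kernel `∑ i, w i * ψ i x * ψ i y`. -/
def spectralKernel (w : Fin p → ℝ) (ψ : Fin p → Ω → ℝ) : Ω → Ω → ℝ :=
  fun x y => ∑ i, w i * ψ i x * ψ i y

/-- The joint law of independent variables `I₁, …, I_p, N`, where `I i` is Bernoulli with
parameter `lam i` and `N` is Poisson with parameter `r`, conditioned on `N + ∑ i, I i = k`. -/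
def conditionedCounts (lam : Fin p → unitInterval) (r : ℝ≥0) (k : ℕ) : Measure ((Fin p → Bool) × ℕ) :=
  ((Measure.pi fun i => bernoulliMeasure true false (lam i)).prod (poissonMeasure r))[|
    {q | q.2 + ∑ i, (q.1 i).toNat = k}]

/-- The law of the output of the following sampler: draw `(ε, n)` from `conditionedCounts`; given
`(ε, n)`, draw independently a configuration with law `D ε` and `n` independent points with
distribution `ν / ν(Ω)`; return the superposition of the two configurations. -/
def conditionedSampler (ν : Measure Ω) (lam : Fin p → unitInterval)
    (D : (Fin p → Bool) → Measure (Multiset Ω)) (k : ℕ) : Measure (Multiset Ω) :=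
  (conditionedCounts lam (ν Set.univ).toNNReal k).bind fun q =>
    ((D q.1).prod (iidLaw ν q.2)).map fun s => s.1 + s.2

end VolumeSampling

end PVS

end

/-!
Volume sampling is recognized as a superposition by expanding its Janossy density, and the laws in
the statement are identified by uniqueness theorems.

*Algebra.* With `A = G^{1/2}`, the matrix `A (G + Λ)⁻¹ A` is the inverse of `1 + A⁻¹ Λ A⁻¹`, so the
eigenvalues lie in `(0, 1]` (`eigenvalue_mem_Ioc`), and the density of volume sampling becomes
`det (1 - D + D Ψᵀ Ψ)`, where `Ψ` is the design matrix of the orthonormal features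
(`det_add_div_det`). This determinant is affine in each eigenvalue, hence is the expectation of its
values when each eigenvalue is rounded independently to `0` or `1` (`det_eq_sum_bernoulliWeight`).
For a `0`-`1` vector it is a principal minor of `Ψᵀ Ψ`, which the Cauchy–Binet formula
(`sum_sq_det_submatrix`) writes as a sum, over tuples of distinct points, of determinants of a
projection kernel.

*Determinantal processes.* For a projection kernel of rank `N`, the law with `N` points and Janossy
density the determinant of the kernel has the right correlation functions, because integrating out a
variable of the `(n + 1)`-st determinant gives `N - n` times the `n`-th
(`lintegral_kernelDet_cons`). By the same affinity in the weights, mixing these laws over independent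
Bernoulli choices of the features gives the process for general weights (`isDPP_dppLaw`). Since the
number of points is bounded by the rank, the correlation functions determine the law
(`ext_of_lintegral_sumDistinct`).

*Poisson process.* The law is determined by its generating functional (`ext_of_genFun`), so it is the
mixture, over a Poisson number of points, of configurations of independent points
(`eq_poissonLaw_of_isPoissonProcess`).

*Superposition.* By the Mecke formula (`tsum_lintegral_sum_embedding`), a density that sums a function
over tuples of distinct Poisson points adds to the Poisson process the points of a process with that
density (`janossyLaw_eq_superposition`). Hence volume sampling is a mixture, over Bernoulli and
Poisson variables, of laws with a deterministic number of points, and conditioning on the number of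
points amounts to conditioning these variables (`bind_cond`).
-/

noncomputable section

namespace PVS

/-! ### Configurations, superposition and sums over distinct points -/

section Configurations

variable {Ω : Type*}

lemma count_add (B : Set Ω) (s t : Multiset Ω) : count B (s + t) = count B s + count B t := by
  classical
  simp [count, Multiset.countP_add]

lemma count_config {n : ℕ} (B : Set Ω) [DecidablePred (· ∈ B)] (x : Fin n → Ω) :
    count B (config x) = ∑ i, if x i ∈ B then 1 else 0 := by
  classical
  rw [count, config, Multiset.countP_map, Finset.sum_boole, ← Finset.filter_val, Finset.card_val]
  simp only [Nat.cast_id]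
  congr

lemma count_univ (s : Multiset Ω) : count Set.univ s = s.card := by
  classical
  simp [count]

@[simp]
lemma card_config {n : ℕ} (x : Fin n → Ω) : (config x).card = n := by
  simp [config]

lemma config_comp_equiv {m n : ℕ} (x : Fin n → Ω) (σ : Fin m ≃ Fin n) :
    config (x ∘ σ) = config x := by
  rw [config, ← Multiset.map_map, Multiset.map_univ_val_equiv σ, config]

lemma config_toList_get (s : Multiset Ω) : config (fun i => s.toList.get i) = s := by
  rw [config]
  conv_rhs => rw [← s.coe_toList, ← List.ofFn_get s.toList]
  simp [List.ofFn_eq_map]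

lemma prod_map_config {M : Type*} [CommMonoid M] (h : Ω → M) {n : ℕ} (x : Fin n → Ω) :
    ((config x).map h).prod = ∏ i, h (x i) := by
  rw [config, Multiset.map_map]
  rfl

lemma sum_map_config {M : Type*} [AddCommMonoid M] (h : Ω → M) {n : ℕ} (x : Fin n → Ω) :
    ((config x).map h).sum = ∑ i, h (x i) := by
  rw [config, Multiset.map_map]
  rfl

/-- Two labellings of the same configuration differ by a bijection between the labels. -/
lemma exists_equiv_of_config_eq {m n : ℕ} {x : Fin m → Ω} {y : Fin n → Ω}
    (h : config x = config y) : ∃ σ : Fin m ≃ Fin n, ∀ i, y (σ i) = x i := by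
  classical
  have hc : ∀ a, Fintype.card {i // x i = a} = Fintype.card {i // y i = a} := by
    intro a
    have key : ∀ {k : ℕ} (z : Fin k → Ω),
        (config z).count a = Fintype.card {i // z i = a} := by
      intro k z
      rw [config, Multiset.count_map, Fintype.card_subtype, ← Finset.filter_val, Finset.card_val]
      congr 1
      ext i
      simp [eq_comm]
    rw [← key, ← key, h]
  let e : ∀ a, {i // x i = a} ≃ {i // y i = a} := fun a => (Fintype.card_eq.1 (hc a)).some
  exact ⟨Equiv.ofFiberEquiv e, fun i => Equiv.ofFiberEquiv_map e i⟩

/-- `sumDistinct` may be computed from any labelling of the configuration. -/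
lemma sumDistinct_config {n N : ℕ} (f : (Fin n → Ω) → ℝ≥0∞) (x : Fin N → Ω) :
    sumDistinct f (config x) = ∑ e : Fin n ↪ Fin N, f (fun i => x (e i)) := by
  obtain ⟨σ, hσ⟩ := exists_equiv_of_config_eq (config_toList_get (config x))
  rw [sumDistinct]
  refine Fintype.sum_equiv (Equiv.embeddingCongr (Equiv.refl _) σ) _ _ fun e => ?_
  exact congrArg f (funext fun i => (hσ (e i)).symm)

/-- Splitting off one label: a sum over `n + 1` distinct labels is a sum over `n` distinct labels
and a label that differs from them. -/
lemma sumDistinct_succ {n : ℕ} (g : Ω → ℝ≥0∞) (f : (Fin n → Ω) → ℝ≥0∞) (s : Multiset Ω) :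
    sumDistinct (fun x : Fin (n + 1) → Ω => g (x 0) * f (Fin.tail x)) s +
        ∑ i, sumDistinct (fun x => g (x i) * f x) s = (s.map g).sum * sumDistinct f s := by
  classical
  obtain ⟨N, x, rfl⟩ : ∃ (N : ℕ) (x : Fin N → Ω), s = config x := ⟨_, _, (config_toList_get s).symm⟩
  simp only [sumDistinct_config, sum_map_config]
  rw [Fintype.sum_equiv (Equiv.embeddingFinSucc n (Fin N)) _
    (fun q => g (x q.2) * f (fun i => x (q.1 i))), Fintype.sum_sigma, Finset.sum_comm,
    ← Finset.sum_add_distrib, Finset.mul_sum]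
  · refine Finset.sum_congr rfl fun e _ => ?_
    dsimp only
    rw [← Finset.sum_mul, ← Finset.sum_mul, ← add_mul]
    congr 1
    rw [add_comm, ← Fintype.sum_subtype_add_sum_subtype (fun a => a ∈ Set.range e)]
    congr 1
    convert! Fintype.sum_equiv (Equiv.ofInjective e e.injective) (fun i => g (x (e i)))
      (fun a => g (x a)) fun i => rfl
  · intro e
    rfl

/-- A sum over `n + 1` distinct labels of a function that ignores one of them. -/
lemma sumDistinct_tail {n : ℕ} (f : (Fin n → Ω) → ℝ≥0∞) (s : Multiset Ω) :
    sumDistinct (fun x : Fin (n + 1) → Ω => f (Fin.tail x)) s =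
      (s.card - n : ℕ) * sumDistinct f s := by
  classical
  obtain ⟨N, x, rfl⟩ : ∃ (N : ℕ) (x : Fin N → Ω), s = config x := ⟨_, _, (config_toList_get s).symm⟩
  simp only [sumDistinct_config]
  rw [Fintype.sum_equiv (Equiv.embeddingFinSucc n (Fin N)) _
    (fun q => f (fun i => x (q.1 i))), Fintype.sum_sigma, Finset.mul_sum]
  · refine Finset.sum_congr rfl fun e _ => ?_
    have h : Fintype.card {a // a ∉ Set.range e} = N - n := by
      rw [Fintype.card_subtype_compl, Fintype.card_fin]
      congr 1
      exact (Fintype.card_congr (Equiv.ofInjective e e.injective).symm).trans (Fintype.card_fin n)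
    simp only [Finset.sum_const, Finset.card_univ, h, nsmul_eq_mul, card_config]
  · intro e
    rfl

lemma sumDistinct_one {n : ℕ} (s : Multiset Ω) :
    sumDistinct (fun _ : Fin n → Ω => 1) s = (s.card.descFactorial n : ℕ) := by
  simp [sumDistinct, Fintype.card_embedding_eq]

lemma sumDistinct_eq_zero {n : ℕ} {f : (Fin n → Ω) → ℝ≥0∞} {s : Multiset Ω} (h : s.card < n) :
    sumDistinct f s = 0 := by
  have : IsEmpty (Fin n ↪ Fin s.toList.length) := by
    rw [← Fintype.card_eq_zero_iff, Fintype.card_embedding_eq]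
    simpa using h
  simp [sumDistinct]

/-- Summing a symmetric function over the labellings of the whole configuration. -/
lemma sumDistinct_comp_config {n : ℕ} (g : Multiset Ω → ℝ≥0∞) {s : Multiset Ω} (h : s.card = n) :
    sumDistinct (fun x : Fin n → Ω => g (config x)) s = n.factorial * g s := by
  subst h
  obtain ⟨N, x, rfl⟩ : ∃ (N : ℕ) (x : Fin N → Ω), s = config x := ⟨_, _, (config_toList_get s).symm⟩
  rw [sumDistinct_config]
  have : ∀ e : Fin (config x).card ↪ Fin N, g (config fun i => x (e i)) = g (config x) := by
    intro e
    have hb : Function.Bijective e :=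
      (Fintype.bijective_iff_injective_and_card _).2 ⟨e.injective, by simp⟩
    exact congrArg g (config_comp_equiv x (Equiv.ofBijective e hb))
  simp [this, Fintype.card_embedding_eq, Nat.descFactorial_self]

lemma sum_map_indicator (B : Set Ω) (s : Multiset Ω) :
    (s.map (B.indicator (fun _ => (1 : ℝ≥0∞)))).sum = count B s := by
  classical
  induction s using Multiset.induction_on with
  | empty => simp [count]
  | cons a s ih =>
    rw [Multiset.map_cons, Multiset.sum_cons, ih, count, count, Multiset.countP_cons]
    by_cases h : a ∈ B <;> simp [h, add_comm]

end Configurations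

section Measurability

variable {Ω : Type*} [MeasurableSpace Ω]

/-- A map into configurations is measurable as soon as its counts are. -/
lemma measurable_of_count {α : Type*} [MeasurableSpace α] {F : α → Multiset Ω}
    (h : ∀ B : Set Ω, MeasurableSet B → Measurable fun a => count B (F a)) : Measurable F := by
  intro t ht
  have : (instMeasurableSpaceMultiset : MeasurableSpace (Multiset Ω)) ≤
      MeasurableSpace.map F inferInstance := by
    refine iSup₂_le fun B hB => ?_
    rintro _ ⟨t, -, rfl⟩
    exact h B hB (MeasurableSet.of_discrete (s := t))
  exact this t ht

lemma measurable_config {n : ℕ} : Measurable (config : (Fin n → Ω) → Multiset Ω) := by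
  classical
  refine measurable_of_count fun B hB => ?_
  simp only [count_config]
  exact Finset.measurable_sum _ fun i _ =>
    Measurable.ite (measurable_pi_apply i hB) measurable_const measurable_const

lemma measurable_superposition :
    Measurable fun s : Multiset Ω × Multiset Ω => s.1 + s.2 := by
  refine measurable_of_count fun B hB => ?_
  simp only [count_add]
  exact ((measurable_count hB).comp measurable_fst).add ((measurable_count hB).comp measurable_snd)

lemma measurable_card : Measurable (Multiset.card : Multiset Ω → ℕ) := by
  have := measurable_count (Ω := Ω) MeasurableSet.univ
  simpa only [funext (count_univ (Ω := Ω))] using this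

lemma measurableSet_card_eq (k : ℕ) : MeasurableSet {s : Multiset Ω | s.card = k} :=
  measurable_card (measurableSet_singleton k)

/-- The sum of Dirac masses at the tuples of distinctly labelled points of the configuration. -/
def distinctTuples (n : ℕ) (s : Multiset Ω) : Measure (Fin n → Ω) :=
  ∑ e : Fin n ↪ Fin s.toList.length, Measure.dirac fun i => s.toList.get (e i)

instance (n : ℕ) (s : Multiset Ω) : IsFiniteMeasure (distinctTuples n s) := by
  unfold distinctTuples
  infer_instance

lemma lintegral_distinctTuples {n : ℕ} {f : (Fin n → Ω) → ℝ≥0∞} (hf : Measurable f)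
    (s : Multiset Ω) : ∫⁻ x, f x ∂(distinctTuples n s) = sumDistinct f s := by
  rw [distinctTuples, lintegral_finsetSum_measure, sumDistinct]
  simp [lintegral_dirac' _ hf]

/-- For a box, `sumDistinct` is a polynomial in the counts of intersections of its sides: split off
the first label, by `sumDistinct_succ`, and argue by induction on the number of labels. -/
lemma measurable_sumDistinct_box {n : ℕ} (B : Fin n → Set Ω) (hB : ∀ i, MeasurableSet (B i)) :
    Measurable (sumDistinct fun x => ∏ i, (B i).indicator (fun _ => (1 : ℝ≥0∞)) (x i)) := by
  classical
  induction n with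
  | zero =>
    have : (sumDistinct fun _ : Fin 0 → Ω => (1 : ℝ≥0∞)) = fun _ => 1 := by
      funext s
      simp [sumDistinct]
    simp [this]
  | succ n ih =>
    have key : ∀ s, sumDistinct (fun x => ∏ i, (B i).indicator (fun _ => (1 : ℝ≥0∞)) (x i)) s =
        (count (B 0) s : ℝ≥0∞) *
          sumDistinct (fun x => ∏ i, (B i.succ).indicator (fun _ => (1 : ℝ≥0∞)) (x i)) s -
        ∑ i, sumDistinct (fun x => ∏ j, (Function.update (Fin.tail B) i
          (B i.succ ∩ B 0) j).indicator (fun _ => (1 : ℝ≥0∞)) (x j)) s := by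
      intro s
      rw [← sum_map_indicator, ← sumDistinct_succ]
      have h1 : ∀ i : Fin n, (fun x : Fin n → Ω => ∏ j, (Function.update (Fin.tail B) i
          (B i.succ ∩ B 0) j).indicator (fun _ => (1 : ℝ≥0∞)) (x j)) =
          fun x => (B 0).indicator (fun _ => (1 : ℝ≥0∞)) (x i) *
            ∏ i, (B i.succ).indicator (fun _ => (1 : ℝ≥0∞)) (x i) := by
        intro i
        funext x
        rw [← Finset.mul_prod_erase _ _ (Finset.mem_univ i),
          ← Finset.mul_prod_erase (a := i) Finset.univ _ (Finset.mem_univ i), ← mul_assoc]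
        congr 1
        · by_cases h0 : x i ∈ B 0 <;> by_cases h2 : x i ∈ B i.succ <;> simp [h0, h2]
        · refine Finset.prod_congr rfl fun j hj => ?_
          rw [Function.update_of_ne (Finset.ne_of_mem_erase hj), Fin.tail]
      simp only [h1]
      rw [ENNReal.add_sub_cancel_right]
      · simp [Fin.prod_univ_succ, Fin.tail]
      · refine ENNReal.sum_ne_top.2 fun i _ => ENNReal.sum_ne_top.2 fun e _ => ?_
        refine ENNReal.mul_ne_top ?_ (ENNReal.prod_ne_top fun j _ => ?_)
        all_goals
          rw [Set.indicator_apply]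
          split_ifs <;> simp
    rw [funext key]
    refine Measurable.sub ?_ (Finset.measurable_sum _ fun i _ => ih _ fun j => ?_)
    · exact ((measurable_from_top (f := fun n : ℕ => (n : ℝ≥0∞))).comp
        (measurable_count (hB 0))).mul (ih _ fun i => hB i.succ)
    · by_cases h : j = i
      · subst h
        simpa using (hB _).inter (hB 0)
      · simpa [h, Fin.tail] using hB j.succ

/-- Boxes form a π-system that generates the product σ-algebra, so measurability need only be checked
there. -/
lemma measurable_distinctTuples (n : ℕ) :
    Measurable (distinctTuples n : Multiset Ω → Measure (Fin n → Ω)) := by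
  classical
  refine Measurable.measure_of_isPiSystem generateFrom_pi.symm isPiSystem_pi ?_ ?_
  · rintro _ ⟨B, hB, rfl⟩
    have hB' : ∀ i, MeasurableSet (B i) := fun i => hB i (Set.mem_univ i)
    convert measurable_sumDistinct_box B hB' using 2 with s
    rw [← lintegral_indicator_one (MeasurableSet.univ_pi hB'), lintegral_distinctTuples
      (measurable_one.indicator (MeasurableSet.univ_pi hB'))]
    congr 1
    funext x
    by_cases h : ∀ i, x i ∈ B i
    · simp [h]
    · obtain ⟨i, hi⟩ := not_forall.1 h
      rw [Finset.prod_eq_zero (Finset.mem_univ i) (by simp [hi])]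
      simpa using ⟨i, hi⟩
  · have : ∀ s : Multiset Ω, distinctTuples n s Set.univ = (s.card.descFactorial n : ℕ) := by
      intro s
      rw [← sumDistinct_one, ← lintegral_distinctTuples measurable_const, lintegral_one]
    rw [funext this]
    exact (measurable_from_top (f := fun k : ℕ => ((k.descFactorial n : ℕ) : ℝ≥0∞))).comp
      measurable_card

lemma measurable_sumDistinct {n : ℕ} {f : (Fin n → Ω) → ℝ≥0∞} (hf : Measurable f) :
    Measurable (sumDistinct f) := by
  have := (Measure.measurable_lintegral hf).comp (measurable_distinctTuples n)
  exact (funext fun s => lintegral_distinctTuples hf s : _ = sumDistinct f) ▸ this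

lemma sum_restrict_fiber {α : Type*} [MeasurableSpace α] (μ : Measure α) {c : α → ℕ}
    (hc : Measurable c) : Measure.sum (fun k : ℕ => μ.restrict {a | c a = k}) = μ := by
  have hm : ∀ k, MeasurableSet {a | c a = k} := fun k => hc (measurableSet_singleton k)
  rw [← Measure.restrict_iUnion (fun i j hij => Set.disjoint_left.2 fun s hi hj =>
    hij (hi.symm.trans hj)) hm]
  convert Measure.restrict_univ
  ext s
  simp

end Measurability

/-! ### Determinants -/

section Determinants

open Matrix

/-- Expansion of a determinant bordered by its first row and column. -/
lemma det_bordered {n : ℕ} (M : Matrix (Fin (n + 1)) (Fin (n + 1)) ℝ) :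
    M.det = M 0 0 * (M.submatrix Fin.succ Fin.succ).det -
      ∑ k, ∑ j, M k.succ 0 * M 0 j.succ * (M.submatrix Fin.succ Fin.succ).adjugate j k := by
  rw [Matrix.det_succ_column_zero, Fin.sum_univ_succ, sub_eq_add_neg, ← Finset.sum_neg_distrib]
  congr 1
  · simp
  refine Finset.sum_congr rfl fun k _ => ?_
  -- In the minor of an entry of the first column, the first row of `M` is moved to the place of the
  -- deleted row.
  have hrow : (M.submatrix k.succ.succAbove Fin.succ).det =
      (-1) ^ (k : ℕ) * ((M.submatrix Fin.succ Fin.succ).updateRow k fun j => M 0 j.succ).det := by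
    obtain _ | n := n
    · exact k.elim0
    have : M.submatrix k.succ.succAbove Fin.succ =
        ((M.submatrix Fin.succ Fin.succ).updateRow k fun j => M 0 j.succ).submatrix
          k.cycleRange.symm id := by
      ext a b
      refine Fin.cases ?_ (fun a => ?_) a
      · simp
      · simp [Fin.succAbove_ne]
    rw [this, Matrix.det_permute]
    simp
  -- Cramer's rule expands the resulting determinant along that row.
  have hcr : ((M.submatrix Fin.succ Fin.succ).updateRow k fun j => M 0 j.succ).det =
      ∑ j, M 0 j.succ * (M.submatrix Fin.succ Fin.succ).adjugate j k := by
    rw [← Matrix.cramer_transpose_apply, Matrix.cramer_eq_adjugate_mulVec,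
      ← Matrix.adjugate_transpose, Matrix.mulVec, dotProduct]
    simp [mul_comm]
  rw [hrow, hcr, ← Finset.sum_neg_distrib, Finset.mul_sum, Finset.mul_sum]
  refine Finset.sum_congr rfl fun j _ => ?_
  have h1 : ((-1 : ℝ) ^ (k : ℕ)) * (-1) ^ (k : ℕ) = 1 := by
    rw [← mul_pow]; simp
  rw [Fin.val_succ, pow_succ]
  linear_combination (-(M k.succ 0 * (M 0 j.succ *
    (M.submatrix Fin.succ Fin.succ).adjugate j k))) * h1

/-- The probability that independent Bernoulli variables with parameters `w i` take the
values `ε i`. -/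
def bernoulliWeight {p : ℕ} (w : Fin p → ℝ) (ε : Fin p → Bool) : ℝ :=
  ∏ i, if ε i then w i else 1 - w i

/-- The number of successes, as a function of the outcome. -/
def successes {p : ℕ} (ε : Fin p → Bool) : ℕ := ∑ i, (ε i).toNat

/-- The `0`-`1` vector of an outcome. -/
def indicatorVec {p : ℕ} (ε : Fin p → Bool) : Fin p → ℝ := fun i => ((ε i).toNat : ℝ)

lemma bernoulliWeight_nonneg {p : ℕ} {w : Fin p → ℝ} (hw : ∀ i, w i ∈ unitInterval)
    (ε : Fin p → Bool) : 0 ≤ bernoulliWeight w ε :=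
  Finset.prod_nonneg fun i _ => by
    split_ifs
    · exact (hw i).1
    · exact sub_nonneg.2 (hw i).2

lemma indicatorVec_nonneg {p : ℕ} (ε : Fin p → Bool) (i : Fin p) : 0 ≤ indicatorVec ε i :=
  Nat.cast_nonneg _

/-- A function that is affine in each variable is its own expectation under independent roundings
of the variables to `0` and `1`. -/
lemma eq_sum_bernoulliWeight {p : ℕ} (F : (Fin p → ℝ) → ℝ)
    (hF : ∀ w i, F w = (1 - w i) * F (Function.update w i 0) + w i * F (Function.update w i 1))
    (w : Fin p → ℝ) : F w = ∑ ε, bernoulliWeight w ε * F (indicatorVec ε) := by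
  induction p with
  | zero =>
    simp only [Fintype.sum_unique, bernoulliWeight, Finset.univ_eq_empty, Finset.prod_empty, one_mul]
    exact congrArg F (Subsingleton.elim _ _)
  | succ p ih =>
    have hG : ∀ b : ℝ, ∀ u i, F (Fin.cons b u) = (1 - u i) * F (Fin.cons b (Function.update u i 0)) +
        u i * F (Fin.cons b (Function.update u i 1)) := by
      intro b u i
      simpa using hF (Fin.cons b u) i.succ
    have h0 := ih (fun u => F (Fin.cons 0 u)) (hG 0) (Fin.tail w)
    have h1 := ih (fun u => F (Fin.cons 1 u)) (hG 1) (Fin.tail w)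
    have hc : ∀ (b : Bool) (ε : Fin p → Bool), indicatorVec (Fin.cons b ε : Fin (p + 1) → Bool) =
        Fin.cons (b.toNat : ℝ) (indicatorVec ε) := by
      intro b ε
      ext i
      refine Fin.cases ?_ (fun i => ?_) i <;> simp [indicatorVec]
    have hu : ∀ t : ℝ, Function.update w 0 t = Fin.cons t (Fin.tail w) := by
      intro t
      conv_lhs => rw [← Fin.cons_self_tail w, Fin.update_cons_zero]
    rw [← (Fin.consEquiv (fun _ => Bool)).sum_comp, Fintype.sum_prod_type, Fintype.sum_bool,
      hF w 0, hu, hu, h0, h1, Finset.mul_sum, Finset.mul_sum, add_comm]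
    congr 1 <;>
      refine Finset.sum_congr rfl fun ε _ => ?_ <;>
      simp [bernoulliWeight, Fin.prod_univ_succ, Fin.consEquiv, hc, Fin.tail, mul_assoc]

lemma sum_bernoulliWeight {p : ℕ} (w : Fin p → ℝ) : ∑ ε, bernoulliWeight w ε = 1 := by
  simpa using (eq_sum_bernoulliWeight (fun _ => 1) (fun w i => by ring) w).symm

/-- A determinant in which each variable enters, in an affine way, a single row of its own is the
expectation of its values at independent roundings of the variables to `0` and `1`. -/
lemma det_eq_sum_bernoulliWeight {p : ℕ} {m : Type*} [Fintype m] [DecidableEq m]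
    (A : (Fin p → ℝ) → Matrix m m ℝ) (r : Fin p → m)
    (hrow : ∀ w i j, A w (r i) j =
      (1 - w i) * A (Function.update w i 0) (r i) j + w i * A (Function.update w i 1) (r i) j)
    (hoth : ∀ w i t k, k ≠ r i → ∀ j, A (Function.update w i t) k j = A w k j) (w : Fin p → ℝ) :
    (A w).det = ∑ ε, bernoulliWeight w ε * (A (indicatorVec ε)).det := by
  refine eq_sum_bernoulliWeight (fun w => (A w).det) (fun w i => ?_) w
  have hu : ∀ t, A (Function.update w i t) =
      (A w).updateRow (r i) (A (Function.update w i t) (r i)) := by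
    intro t
    ext k j
    by_cases hk : k = r i
    · subst hk; simp
    · simp [hk, hoth w i t k hk j]
  have h : A w = (A w).updateRow (r i) ((1 - w i) • A (Function.update w i 0) (r i) +
      w i • A (Function.update w i 1) (r i)) := by
    ext k j
    by_cases hk : k = r i
    · subst hk; simpa using hrow w i j
    · simp [hk]
  change (A w).det = (1 - w i) * (A _).det + w i * (A _).det
  rw [h, hu 0, hu 1, det_updateRow_add, det_updateRow_smul, det_updateRow_smul]
  simp

/-- The determinant of a weighted Gram matrix is the expectation of the determinants obtained by
keeping each feature independently with probability its weight. -/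
lemma det_mul_diagonal_mul_transpose {p n : ℕ} (Ψ : Matrix (Fin n) (Fin p) ℝ) (w : Fin p → ℝ) :
    (Ψ * diagonal w * Ψᵀ).det =
      ∑ ε, bernoulliWeight w ε * (Ψ * diagonal (indicatorVec ε) * Ψᵀ).det := by
  -- A Schur complement: in the block matrix, each weight occurs in a single row.
  have h : ∀ w : Fin p → ℝ, (Ψ * diagonal w * Ψᵀ).det =
      (fromBlocks 1 (-(diagonal w * Ψᵀ)) Ψ 0).det := by
    intro w
    rw [det_fromBlocks_one₁₁, Matrix.mul_neg, zero_sub, neg_neg, Matrix.mul_assoc]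
  simp only [h]
  refine det_eq_sum_bernoulliWeight (fun w => fromBlocks 1 (-(diagonal w * Ψᵀ)) Ψ 0) Sum.inl
    (fun w i j => ?_) (fun w i t k hk j => ?_) w
  · cases j <;> simp [diagonal_mul]
    ring
  · cases k with
    | inl k =>
      have : k ≠ i := fun h => hk (by rw [h])
      cases j <;> simp [diagonal_mul, this]
    | inr k => cases j <;> simp

/-- Row `i` of this matrix interpolates between row `i` of `1` and of `M`, with weight `w i`. -/
lemma det_one_sub_diagonal_add {p : ℕ} (M : Matrix (Fin p) (Fin p) ℝ) (w : Fin p → ℝ) :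
    (1 - diagonal w + diagonal w * M).det = ∑ ε, bernoulliWeight w ε *
      (1 - diagonal (indicatorVec ε) + diagonal (indicatorVec ε) * M).det := by
  refine det_eq_sum_bernoulliWeight (fun w => 1 - diagonal w + diagonal w * M) id
    (fun w i j => ?_) (fun w i t k hk j => ?_) w
  · by_cases h : i = j
    · subst h; simp [diagonal_mul]
    · simp [diagonal_mul, h]
  · have : k ≠ i := hk
    by_cases h : k = j
    · subst h; simp [diagonal_mul, this]
    · simp [diagonal_mul, h, this]

/-- With weights `0` and `1`, only the principal minor of the kept features remains. -/
lemma det_one_sub_indicator_add {p : ℕ} (M : Matrix (Fin p) (Fin p) ℝ) (ε : Fin p → Bool) :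
    (1 - diagonal (indicatorVec ε) + diagonal (indicatorVec ε) * M).det =
      (M.submatrix (Subtype.val : {i // ε i = true} → Fin p) Subtype.val).det := by
  rw [twoBlockTriangular_det _ (fun i => ε i = true)]
  · have h1 : toSquareBlockProp (1 - diagonal (indicatorVec ε) + diagonal (indicatorVec ε) * M)
        (fun i => ε i = true) =
        M.submatrix (Subtype.val : {i // ε i = true} → Fin p) Subtype.val := by
      ext i j
      by_cases h : i.1 = j.1
      · have h' : i = j := Subtype.ext h
        subst h'
        simp [toSquareBlockProp_def, diagonal_mul, indicatorVec, i.2]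
      · simp [toSquareBlockProp_def, diagonal_mul, indicatorVec, i.2, h]
    have h2 : toSquareBlockProp (1 - diagonal (indicatorVec ε) + diagonal (indicatorVec ε) * M)
        (fun i => ¬ ε i = true) = 1 := by
      ext i j
      by_cases h : i = j
      · subst h
        simp [toSquareBlockProp_def, diagonal_mul, indicatorVec, i.2]
      · have h' : i.1 ≠ j.1 := fun h' => h (Subtype.ext h')
        simp [toSquareBlockProp_def, diagonal_mul, indicatorVec, i.2, h, h']
    rw [h1, h2, det_one, mul_one]
  · intro i hi j hj
    have h : i ≠ j := fun h => hi (h ▸ hj)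
    simp [diagonal_mul, indicatorVec, hi, h]

/-- The Cauchy–Binet formula, summed over all maps instead of all subsets. -/
lemma sum_sq_det_submatrix {n κ : Type*} [Fintype n] [DecidableEq n] [Fintype κ] [DecidableEq κ]
    (A : Matrix n κ ℝ) :
    ∑ c : κ → n, (A.submatrix c id).det ^ 2 = (Fintype.card κ).factorial * (Aᵀ * A).det := by
  -- Multilinearity in the rows.
  have h1 : (Aᵀ * A).det = ∑ c : κ → n, (∏ i, A (c i) i) * (A.submatrix c id).det := by
    have : Aᵀ * A = fun i => ∑ k, A k i • A k := by
      ext i j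
      simp [Matrix.mul_apply, Finset.sum_apply]
    rw [this]
    change detRowAlternating (fun i => ∑ k, A k i • A k) = _
    rw [← AlternatingMap.coe_multilinearMap, MultilinearMap.map_sum]
    refine Finset.sum_congr rfl fun c _ => ?_
    rw [MultilinearMap.map_smul_univ]
    rfl
  -- Relabelling the maps `c` by a permutation; summing over all of them completes the first factor
  -- to a second determinant.
  have h2 : ∀ σ : Equiv.Perm κ, (Aᵀ * A).det =
      ∑ c : κ → n, (Equiv.Perm.sign σ : ℝ) * (∏ i, A (c (σ i)) i) * (A.submatrix c id).det := by
    intro σ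
    rw [h1, ← (Equiv.arrowCongr σ.symm (Equiv.refl n)).sum_comp]
    refine Finset.sum_congr rfl fun c _ => ?_
    have : A.submatrix ((Equiv.arrowCongr σ.symm (Equiv.refl n)) c) id =
        (A.submatrix c id).submatrix σ id := by
      ext i j; simp
    rw [this, det_permute]
    simp
    ring
  rw [← Fintype.card_perm, ← nsmul_eq_mul, ← Finset.card_univ, ← Finset.sum_const,
    Finset.sum_congr rfl fun σ _ => h2 σ, Finset.sum_comm]
  refine Finset.sum_congr rfl fun c _ => ?_
  rw [← Finset.sum_mul, pow_two]
  congr 1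
  rw [det_apply]
  simp [Units.smul_def]

/-- The principal minor of the kept features in the Gram matrix `Ψᵀ Ψ` is, up to the factor
`(successes ε)!`, the sum of the minors of the kernel matrix over tuples of distinct rows. -/
lemma sum_det_submatrix_embedding {p n : ℕ} (Ψ : Matrix (Fin n) (Fin p) ℝ) (ε : Fin p → Bool) :
    ∑ e : Fin (successes ε) ↪ Fin n,
        ((Ψ * diagonal (indicatorVec ε) * Ψᵀ).submatrix e e).det =
      (successes ε).factorial *
        (1 - diagonal (indicatorVec ε) + diagonal (indicatorVec ε) * (Ψᵀ * Ψ)).det := by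
  classical
  have hcard : Fintype.card {i // ε i = true} = successes ε := by
    rw [Fintype.card_subtype, successes, Finset.card_filter]
    exact Finset.sum_congr rfl fun i _ => by cases ε i <;> rfl
  let τ : {i // ε i = true} ≃ Fin (successes ε) := Fintype.equivFinOfCardEq hcard
  let A : Matrix (Fin n) {i // ε i = true} ℝ := Ψ.submatrix id Subtype.val
  have hA : Aᵀ * A = (Ψᵀ * Ψ).submatrix (Subtype.val : {i // ε i = true} → Fin p) Subtype.val := by
    ext i j
    simp [A, Matrix.mul_apply]
  have hK : A * Aᵀ = Ψ * diagonal (indicatorVec ε) * Ψᵀ := by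
    ext i j
    rw [Matrix.mul_apply, Matrix.mul_apply,
      ← Fintype.sum_subtype_add_sum_subtype (fun k => ε k = true)]
    rw [Finset.sum_eq_zero (s := (Finset.univ : Finset {k // ¬ ε k = true}))]
    · rw [add_zero]
      refine Finset.sum_congr rfl fun k _ => ?_
      simp [A, indicatorVec, k.2]
    · intro k _
      have := k.2
      simp [indicatorVec, this]
  rw [det_one_sub_indicator_add, ← hA, ← hcard, ← sum_sq_det_submatrix, hcard]
  -- The minors are squares, the number of rows being the number of kept features.
  have hsq : ∀ c : {i // ε i = true} → Fin n, (A.submatrix c id).det ^ 2 =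
      ((Ψ * diagonal (indicatorVec ε) * Ψᵀ).submatrix (c ∘ τ.symm) (c ∘ τ.symm)).det := by
    intro c
    rw [← submatrix_submatrix, det_submatrix_equiv_self, ← hK, pow_two]
    nth_rw 2 [← det_transpose]
    rw [← det_mul]
    rfl
  rw [Finset.sum_congr rfl fun c _ => hsq c]
  refine Eq.trans ?_ ((Equiv.arrowCongr τ (Equiv.refl (Fin n))).sum_comp
    (fun c => ((Ψ * diagonal (indicatorVec ε) * Ψᵀ).submatrix c c).det)).symm
  rw [← Finset.sum_subset (Finset.subset_univ (Finset.univ.map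
    ⟨fun e : Fin (successes ε) ↪ Fin n => (e : Fin (successes ε) → Fin n), DFunLike.coe_injective⟩)),
    Finset.sum_map]
  · rfl
  · -- A map that is not injective repeats a row.
    intro c _ hc
    have hinj : ¬ Function.Injective c := fun h => hc (by simpa using ⟨⟨c, h⟩, rfl⟩)
    obtain ⟨i, j, hij, hne⟩ := Function.not_injective_iff.1 hinj
    exact det_zero_of_row_eq hne (by ext k; simp [hij])

lemma posSemidef_mul_diagonal_mul_transpose {p n : ℕ} (Ψ : Matrix (Fin n) (Fin p) ℝ)
    {w : Fin p → ℝ} (hw : ∀ i, 0 ≤ w i) : (Ψ * diagonal w * Ψᵀ).PosSemidef := by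
  have := (PosSemidef.diagonal (n := Fin p) (d := w) hw).mul_mul_conjTranspose_same Ψ
  simpa using this

end Determinants

/-! ### Kernels of finite rank -/

section Kernels

open Matrix

variable {Ω : Type*} {p : ℕ}

/-- The determinants that are the correlation functions of the determinantal process with kernel
`spectralKernel w ψ`. -/
def kernelDet (w : Fin p → ℝ) (ψ : Fin p → Ω → ℝ) (n : ℕ) (x : Fin n → Ω) : ℝ :=
  Matrix.det (Matrix.of fun i j : Fin n => spectralKernel w ψ (x i) (x j))

lemma of_spectralKernel (w : Fin p → ℝ) (ψ : Fin p → Ω → ℝ) {n : ℕ} (x : Fin n → Ω) :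
    (Matrix.of fun i j : Fin n => spectralKernel w ψ (x i) (x j)) =
      design ψ x * diagonal w * (design ψ x)ᵀ := by
  ext i j
  simp [spectralKernel, design, Matrix.mul_apply, diagonal, mul_comm]

lemma kernelDet_nonneg {w : Fin p → ℝ} (hw : ∀ i, 0 ≤ w i) (ψ : Fin p → Ω → ℝ) {n : ℕ}
    (x : Fin n → Ω) : 0 ≤ kernelDet w ψ n x := by
  rw [kernelDet, of_spectralKernel]
  exact (posSemidef_mul_diagonal_mul_transpose _ hw).det_nonneg

lemma kernelDet_eq_sum (w : Fin p → ℝ) (ψ : Fin p → Ω → ℝ) {n : ℕ} (x : Fin n → Ω) :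
    kernelDet w ψ n x = ∑ ε, bernoulliWeight w ε * kernelDet (indicatorVec ε) ψ n x := by
  simp only [kernelDet, of_spectralKernel]
  exact det_mul_diagonal_mul_transpose _ _

lemma kernelDet_comp_equiv (w : Fin p → ℝ) (ψ : Fin p → Ω → ℝ) {n : ℕ} (x : Fin n → Ω)
    (σ : Equiv.Perm (Fin n)) : kernelDet w ψ n (x ∘ σ) = kernelDet w ψ n x :=
  det_submatrix_equiv_self σ (Matrix.of fun i j : Fin n => spectralKernel w ψ (x i) (x j))

lemma kernelDet_zero (w : Fin p → ℝ) (ψ : Fin p → Ω → ℝ) (x : Fin 0 → Ω) :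
    kernelDet w ψ 0 x = 1 := by
  simp [kernelDet]

lemma successes_le (ε : Fin p → Bool) : successes ε ≤ p := by
  simpa [successes] using Finset.sum_le_card_nsmul Finset.univ _ 1 fun i _ => Bool.toNat_le (ε i)

variable [MeasurableSpace Ω]

lemma measurable_kernelDet (w : Fin p → ℝ) {ψ : Fin p → Ω → ℝ} (hψ : ∀ i, Measurable (ψ i))
    (n : ℕ) : Measurable (kernelDet w ψ n) := by
  unfold kernelDet spectralKernel
  simp only [det_apply, of_apply]
  fun_prop

/-- Integrating out one variable of the correlation functions of a projection kernel `K`: expand the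
determinant bordered by the row and column of the variable `z`, and use that
`∫ K z z = successes ε`, that `∫ K a z * K z b = K a b`, and that `A * adj A` has trace
`n * det A`. -/
lemma lintegral_kernelDet_cons {ν : Measure Ω} [IsFiniteMeasure ν] {ψ : Fin p → Ω → ℝ}
    (hψ : ∀ i, MemLp (ψ i) 2 ν)
    (ho : ∀ i j, ∫ x, ψ i x * ψ j x ∂ν = if i = j then 1 else 0) (ε : Fin p → Bool) {n : ℕ}
    (y : Fin n → Ω) :
    ∫⁻ z, ENNReal.ofReal (kernelDet (indicatorVec ε) ψ (n + 1) (Fin.cons z y)) ∂ν +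
        n * ENNReal.ofReal (kernelDet (indicatorVec ε) ψ n y) =
      successes ε * ENNReal.ofReal (kernelDet (indicatorVec ε) ψ n y) := by
  set K := spectralKernel (indicatorVec ε) ψ with hK
  set A : Matrix (Fin n) (Fin n) ℝ := Matrix.of fun i j => K (y i) (y j) with hA
  have hexp : ∀ z, kernelDet (indicatorVec ε) ψ (n + 1) (Fin.cons z y) =
      K z z * A.det - ∑ k, ∑ j, K (y k) z * K z (y j) * A.adjugate j k := by
    intro z
    rw [kernelDet, det_bordered]
    rfl
  have hprod : ∀ i j, Integrable (fun z => ψ i z * ψ j z) ν := fun i j =>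
    (hψ i).integrable_mul (hψ j)
  have hdiag : ∀ z, K z z = ∑ i, indicatorVec ε i * (ψ i z * ψ i z) := fun z => by
    simp [hK, spectralKernel, mul_assoc]
  have hoff : ∀ a b z, K a z * K z b = ∑ i, ∑ j,
      (indicatorVec ε i * ψ i a * (indicatorVec ε j * ψ j b)) * (ψ i z * ψ j z) := fun a b z => by
    simp only [hK, spectralKernel, Finset.sum_mul_sum]
    exact Finset.sum_congr rfl fun i _ => Finset.sum_congr rfl fun j _ => by ring
  have hdi : Integrable (fun z => K z z) ν := by
    simp only [hdiag]
    exact integrable_finsetSum _ fun i _ => (hprod i i).const_mul _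
  have hoi : ∀ a b, Integrable (fun z => K a z * K z b) ν := by
    intro a b
    simp only [hoff]
    exact integrable_finsetSum _ fun i _ => integrable_finsetSum _ fun j _ =>
      (hprod i j).const_mul _
  have hdint : ∫ z, K z z ∂ν = successes ε := by
    simp only [hdiag]
    rw [integral_finsetSum _ fun i _ => (hprod i i).const_mul _]
    simp [integral_const_mul, ho, successes, indicatorVec]
  have hoint : ∀ a b, ∫ z, K a z * K z b ∂ν = K a b := by
    intro a b
    simp only [hoff]
    rw [integral_finsetSum _ fun i _ => integrable_finsetSum _ fun j _ => (hprod i j).const_mul _]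
    simp_rw [integral_finsetSum _ fun j _ => (hprod _ j).const_mul _, integral_const_mul, ho]
    simp only [mul_ite, mul_one, mul_zero, Finset.sum_ite_eq, Finset.mem_univ, if_true, hK,
      spectralKernel]
    refine Finset.sum_congr rfl fun i _ => ?_
    have : indicatorVec ε i * indicatorVec ε i = indicatorVec ε i := by
      cases h : ε i <;> simp [indicatorVec, h]
    linear_combination (ψ i a * ψ i b) * this
  have hint : Integrable (fun z => kernelDet (indicatorVec ε) ψ (n + 1) (Fin.cons z y)) ν := by
    simp only [hexp]
    exact (hdi.mul_const _).sub (integrable_finsetSum _ fun k _ => integrable_finsetSum _ fun j _ =>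
      (hoi _ _).mul_const _)
  have hval : ∫ z, kernelDet (indicatorVec ε) ψ (n + 1) (Fin.cons z y) ∂ν =
      successes ε * A.det - n * A.det := by
    simp only [hexp]
    rw [integral_sub (hdi.mul_const _) (integrable_finsetSum _ fun k _ =>
      integrable_finsetSum _ fun j _ => (hoi _ _).mul_const _), integral_mul_const, hdint,
      integral_finsetSum _ fun k _ => integrable_finsetSum _ fun j _ => (hoi _ _).mul_const _]
    simp_rw [integral_finsetSum _ fun j _ => (hoi _ _).mul_const _, integral_mul_const, hoint]
    congr 1
    have := congrArg Matrix.trace (Matrix.mul_adjugate A)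
    simpa [Matrix.trace, Matrix.mul_apply, hA, mul_comm] using this
  have hdet : kernelDet (indicatorVec ε) ψ n y = A.det := rfl
  have hnn : ∀ᵐ z ∂ν, 0 ≤ kernelDet (indicatorVec ε) ψ (n + 1) (Fin.cons z y) :=
    Filter.Eventually.of_forall fun z => kernelDet_nonneg (indicatorVec_nonneg ε) _ _
  have hA0 : 0 ≤ A.det := kernelDet_nonneg (indicatorVec_nonneg ε) ψ y
  rw [← ofReal_integral_eq_lintegral_ofReal hint hnn, hdet, ← ENNReal.ofReal_natCast n,
    ← ENNReal.ofReal_natCast (successes ε), ← ENNReal.ofReal_mul (by positivity),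
    ← ENNReal.ofReal_mul (by positivity), ← ENNReal.ofReal_add (integral_nonneg_of_ae hnn)
    (by positivity), hval]
  congr 1
  ring

/-- The correlation functions of order larger than the rank vanish: otherwise
`lintegral_kernelDet_cons` would give a negative integral of a nonnegative function. -/
lemma kernelDet_indicator_eq_zero {ν : Measure Ω} [IsFiniteMeasure ν] {ψ : Fin p → Ω → ℝ}
    (hψ : ∀ i, MemLp (ψ i) 2 ν)
    (ho : ∀ i j, ∫ x, ψ i x * ψ j x ∂ν = if i = j then 1 else 0) {ε : Fin p → Bool} {n : ℕ}
    (hn : successes ε < n) (y : Fin n → Ω) : kernelDet (indicatorVec ε) ψ n y = 0 := by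
  by_contra h
  have h0 : 0 < kernelDet (indicatorVec ε) ψ n y :=
    lt_of_le_of_ne (kernelDet_nonneg (indicatorVec_nonneg ε) _ _) (Ne.symm h)
  have h1 := (le_add_left le_rfl).trans (lintegral_kernelDet_cons hψ ho ε y).le
  rw [ENNReal.mul_le_mul_iff_left (by simpa using h0) ENNReal.ofReal_ne_top] at h1
  exact absurd (Nat.cast_le.1 h1) (not_le.2 hn)

lemma lintegral_kernelDet_cons_of_le {ν : Measure Ω} [IsFiniteMeasure ν] {ψ : Fin p → Ω → ℝ}
    (hψ : ∀ i, MemLp (ψ i) 2 ν)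
    (ho : ∀ i j, ∫ x, ψ i x * ψ j x ∂ν = if i = j then 1 else 0) {ε : Fin p → Bool} {n : ℕ}
    (hn : n ≤ successes ε) (y : Fin n → Ω) :
    ∫⁻ z, ENNReal.ofReal (kernelDet (indicatorVec ε) ψ (n + 1) (Fin.cons z y)) ∂ν =
      (successes ε - n : ℕ) * ENNReal.ofReal (kernelDet (indicatorVec ε) ψ n y) := by
  have h := lintegral_kernelDet_cons hψ ho ε y
  obtain ⟨d, hd⟩ := Nat.exists_eq_add_of_le hn
  rw [hd, Nat.cast_add, add_mul, add_comm] at h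
  rw [hd, Nat.add_sub_cancel_left]
  exact (ENNReal.add_right_inj (ENNReal.mul_ne_top (ENNReal.natCast_ne_top n)
    ENNReal.ofReal_ne_top)).1 h

end Kernels

/-! ### Existence of the determinantal processes -/

section Existence

variable {Ω : Type*} [MeasurableSpace Ω] {p : ℕ}

lemma measurePreserving_comp_equiv (ν : Measure Ω) [SigmaFinite ν] {ι κ : Type*} [Fintype ι]
    [Fintype κ] (σ : ι ≃ κ) :
    MeasurePreserving (fun x : κ → Ω => x ∘ σ) (Measure.pi fun _ => ν) (Measure.pi fun _ => ν) := by
  convert measurePreserving_piCongrLeft (fun _ : ι => ν) σ.symm using 1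
  ext x i
  have := Equiv.piCongrLeft_apply_apply (fun _ : ι => Ω) σ.symm x (σ i)
  rw [Equiv.symm_apply_apply] at this
  exact this.symm

lemma lintegral_comp_equiv (ν : Measure Ω) [SigmaFinite ν] {m n : ℕ} (σ : Fin m ≃ Fin n)
    {g : (Fin m → Ω) → ℝ≥0∞} (hg : Measurable g) :
    ∫⁻ x, g (x ∘ σ) ∂(Measure.pi fun _ : Fin n => ν) = ∫⁻ x, g x ∂(Measure.pi fun _ => ν) :=
  (measurePreserving_comp_equiv ν σ).lintegral_comp hg

lemma lintegral_pi_succ (ν : Measure Ω) [SigmaFinite ν] {n : ℕ} {g : (Fin (n + 1) → Ω) → ℝ≥0∞}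
    (hg : Measurable g) :
    ∫⁻ x, g x ∂(Measure.pi fun _ => ν) =
      ∫⁻ y, ∫⁻ z, g (Fin.cons z y) ∂ν ∂(Measure.pi fun _ : Fin n => ν) := by
  have h := (measurePreserving_piFinSuccAbove (fun _ : Fin (n + 1) => ν) 0).symm
  rw [← h.lintegral_comp hg]
  refine (lintegral_prod_symm' (μ := ν) (ν := Measure.pi fun _ : Fin n => ν) _
    (hg.comp h.measurable)).trans ?_
  refine lintegral_congr fun y => lintegral_congr fun z => congrArg g ?_
  exact Fin.insertNth_zero' z y

/-- The law of the determinantal process whose kernel is the projection onto the span of the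
features kept by `ε`: it has as many points as kept features, and its Janossy density is the
determinant of the kernel. -/
def projectionLaw (ν : Measure Ω) (ψ : Fin p → Ω → ℝ) (ε : Fin p → Bool) : Measure (Multiset Ω) :=
  (((successes ε).factorial : ℝ≥0∞)⁻¹) • ((Measure.pi fun _ : Fin (successes ε) => ν).withDensity
    fun x => ENNReal.ofReal (kernelDet (indicatorVec ε) ψ _ x)).map config

/-- The mixture of the projection processes for independent Bernoulli choices of the features. -/
def dppLaw (ν : Measure Ω) (ψ : Fin p → Ω → ℝ) (w : Fin p → ℝ) : Measure (Multiset Ω) :=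
  ∑ ε, ENNReal.ofReal (bernoulliWeight w ε) • projectionLaw ν ψ ε

lemma lintegral_projectionLaw (ν : Measure Ω) [IsFiniteMeasure ν] {ψ : Fin p → Ω → ℝ}
    (hψm : ∀ i, Measurable (ψ i)) (ε : Fin p → Bool) {F : Multiset Ω → ℝ≥0∞} (hF : Measurable F) :
    ∫⁻ s, F s ∂(projectionLaw ν ψ ε) = ((successes ε).factorial : ℝ≥0∞)⁻¹ *
      ∫⁻ x : Fin (successes ε) → Ω, F (config x) *
        ENNReal.ofReal (kernelDet (indicatorVec ε) ψ _ x) ∂(Measure.pi fun _ => ν) := by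
  rw [projectionLaw, lintegral_smul_measure, lintegral_map hF measurable_config,
    lintegral_withDensity_eq_lintegral_mul _ (measurable_kernelDet _ hψm _).ennreal_ofReal
      (show Measurable fun x => F (config x) from hF.comp measurable_config), smul_eq_mul]
  simp [mul_comm]

lemma ae_card_projectionLaw (ν : Measure Ω) (ψ : Fin p → Ω → ℝ) (ε : Fin p → Bool) :
    ∀ᵐ s ∂(projectionLaw ν ψ ε), s.card = successes ε := by
  refine Measure.ae_smul_measure ?_ _
  rw [ae_map_iff measurable_config.aemeasurable (measurableSet_card_eq _)]
  simp

lemma dppLaw_indicatorVec (ν : Measure Ω) (ψ : Fin p → Ω → ℝ) (ε : Fin p → Bool) :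
    dppLaw ν ψ (indicatorVec ε) = projectionLaw ν ψ ε := by
  rw [dppLaw, Finset.sum_eq_single ε]
  · have : bernoulliWeight (indicatorVec ε) ε = 1 :=
      Finset.prod_eq_one fun i _ => by cases h : ε i <;> simp [indicatorVec, h]
    simp [this]
  · intro δ _ hδ
    obtain ⟨i, hi⟩ := Function.ne_iff.1 hδ
    have : bernoulliWeight (indicatorVec ε) δ = 0 := by
      refine Finset.prod_eq_zero (Finset.mem_univ i) ?_
      cases h : ε i <;> cases h' : δ i <;> simp_all [indicatorVec]
    simp [this]
  · simp

variable {ν : Measure Ω} [IsFiniteMeasure ν] {ψ : Fin p → Ω → ℝ}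

/-- The correlation functions of a projection process are the determinants of its kernel. The one of
the order of the rank is the Janossy density; the lower ones follow by descending induction, both
sides for `n` being obtained from those for `n + 1` by ignoring one of the points. -/
lemma lintegral_sumDistinct_projectionLaw (hψm : ∀ i, Measurable (ψ i))
    (hψ : ∀ i, MemLp (ψ i) 2 ν)
    (ho : ∀ i j, ∫ x, ψ i x * ψ j x ∂ν = if i = j then 1 else 0) (ε : Fin p → Bool) {n : ℕ}
    {f : (Fin n → Ω) → ℝ≥0∞} (hf : Measurable f) :
    ∫⁻ s, sumDistinct f s ∂(projectionLaw ν ψ ε) =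
      ∫⁻ x, f x * ENNReal.ofReal (kernelDet (indicatorVec ε) ψ n x) ∂(Measure.pi fun _ => ν) := by
  have hkm : ∀ n, Measurable fun x => ENNReal.ofReal (kernelDet (indicatorVec ε) ψ n x) := fun n =>
    (measurable_kernelDet _ hψm n).ennreal_ofReal
  have hfk : ∀ {n : ℕ} {f : (Fin n → Ω) → ℝ≥0∞}, Measurable f →
      Measurable fun x => f x * ENNReal.ofReal (kernelDet (indicatorVec ε) ψ n x) :=
    fun hf => hf.mul (hkm _)
  obtain hn | hn := lt_or_ge (successes ε) n
  · have : ∀ᵐ s ∂(projectionLaw ν ψ ε), sumDistinct f s = 0 := by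
      filter_upwards [ae_card_projectionLaw ν ψ ε] with s hs
      exact sumDistinct_eq_zero (hs ▸ hn)
    simp [lintegral_congr_ae this, kernelDet_indicator_eq_zero hψ ho hn]
  obtain ⟨d, hd⟩ := Nat.exists_eq_add_of_le hn
  induction d generalizing n with
  | zero =>
    obtain rfl : successes ε = n := hd
    rw [lintegral_projectionLaw ν hψm ε (measurable_sumDistinct hf)]
    -- The embeddings are permutations, under which the density is invariant.
    have h : ∀ e : Fin (successes ε) ↪ Fin (successes ε),
        ∫⁻ x : Fin (successes ε) → Ω, f (fun i => x (e i)) *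
          ENNReal.ofReal (kernelDet (indicatorVec ε) ψ _ x) ∂(Measure.pi fun _ => ν) =
        ∫⁻ x, f x * ENNReal.ofReal (kernelDet (indicatorVec ε) ψ _ x) ∂(Measure.pi fun _ => ν) := by
      intro e
      let σ : Equiv.Perm (Fin (successes ε)) :=
        Equiv.ofBijective e (Finite.injective_iff_bijective.1 e.injective)
      rw [← lintegral_comp_equiv ν σ (hfk hf)]
      simp only [kernelDet_comp_equiv]
      rfl
    simp only [sumDistinct_config, Finset.sum_mul]
    rw [lintegral_finsetSum _ fun e _ =>
        (show Measurable fun x : Fin (successes ε) → Ω => f (fun i => x (e i)) from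
          hf.comp (measurable_pi_lambda _ fun i => measurable_pi_apply _)).mul (hkm _),
      Finset.sum_congr rfl fun e _ => h e, Finset.sum_const, Finset.card_univ,
      Fintype.card_embedding_eq, Fintype.card_fin, Nat.descFactorial_self, nsmul_eq_mul,
      ← mul_assoc, ENNReal.inv_mul_cancel (by positivity) (ENNReal.natCast_ne_top _), one_mul]
  | succ d ih =>
    have htail : Measurable fun x : Fin (n + 1) → Ω => f (Fin.tail x) :=
      hf.comp (measurable_pi_lambda _ fun i => measurable_pi_apply _)
    have h1 := ih htail (by omega) (by omega)
    have h2 : ∀ᵐ s ∂(projectionLaw ν ψ ε), sumDistinct (fun x : Fin (n + 1) → Ω => f (Fin.tail x)) s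
        = (successes ε - n : ℕ) * sumDistinct f s := by
      filter_upwards [ae_card_projectionLaw ν ψ ε] with s hs
      rw [sumDistinct_tail, hs]
    rw [lintegral_congr_ae h2, lintegral_const_mul _ (measurable_sumDistinct hf),
      lintegral_pi_succ ν (hfk htail)] at h1
    simp only [Fin.tail_cons] at h1
    have h3 : ∀ y : Fin n → Ω, ∫⁻ z, f y * ENNReal.ofReal
        (kernelDet (indicatorVec ε) ψ (n + 1) (Fin.cons z y)) ∂ν =
        (successes ε - n : ℕ) * (f y * ENNReal.ofReal (kernelDet (indicatorVec ε) ψ n y)) := by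
      intro y
      have hcons : Measurable fun z : Ω => (Fin.cons z y : Fin (n + 1) → Ω) := by
        refine measurable_pi_lambda _ fun i => ?_
        refine Fin.cases ?_ (fun i => ?_) i
        · exact measurable_id
        · simp
      rw [lintegral_const_mul _ (show Measurable fun z => ENNReal.ofReal
        (kernelDet (indicatorVec ε) ψ (n + 1) (Fin.cons z y)) from (hkm _).comp hcons),
        lintegral_kernelDet_cons_of_le hψ ho hn]
      ring
    rw [lintegral_congr h3, lintegral_const_mul _ (hfk hf)] at h1
    exact (ENNReal.mul_right_inj (by norm_cast; omega) (ENNReal.natCast_ne_top _)).1 h1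

lemma isProbabilityMeasure_projectionLaw (hψm : ∀ i, Measurable (ψ i))
    (hψ : ∀ i, MemLp (ψ i) 2 ν)
    (ho : ∀ i j, ∫ x, ψ i x * ψ j x ∂ν = if i = j then 1 else 0) (ε : Fin p → Bool) :
    IsProbabilityMeasure (projectionLaw ν ψ ε) := by
  have h := lintegral_sumDistinct_projectionLaw hψm hψ ho ε (n := 0) (f := fun _ => 1)
    measurable_const
  simp only [sumDistinct_one, kernelDet_zero] at h
  exact ⟨by simpa using h⟩

lemma isDPP_dppLaw (hψm : ∀ i, Measurable (ψ i)) (hψ : ∀ i, MemLp (ψ i) 2 ν)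
    (ho : ∀ i j, ∫ x, ψ i x * ψ j x ∂ν = if i = j then 1 else 0) {w : Fin p → ℝ}
    (hw : ∀ i, w i ∈ unitInterval) : IsDPP ν (spectralKernel w ψ) (dppLaw ν ψ w) where
  isProbabilityMeasure := by
    have := isProbabilityMeasure_projectionLaw hψm hψ ho
    refine ⟨?_⟩
    simp only [dppLaw, Measure.finsetSum_apply, Measure.smul_apply, measure_univ, smul_eq_mul,
      mul_one]
    rw [← ENNReal.ofReal_sum_of_nonneg fun ε _ => bernoulliWeight_nonneg hw ε,
      sum_bernoulliWeight, ENNReal.ofReal_one]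
  correlation := by
    intro n f hf
    have hkm : ∀ ε, Measurable fun x => ENNReal.ofReal (kernelDet (indicatorVec ε) ψ n x) :=
      fun ε => (measurable_kernelDet _ hψm n).ennreal_ofReal
    rw [dppLaw, lintegral_finsetSum_measure]
    simp only [lintegral_smul_measure, lintegral_sumDistinct_projectionLaw hψm hψ ho _ hf,
      smul_eq_mul]
    change _ = ∫⁻ x, f x * ENNReal.ofReal (kernelDet w ψ n x) ∂_
    have h : ∀ x, f x * ENNReal.ofReal (kernelDet w ψ n x) =
        ∑ ε, ENNReal.ofReal (bernoulliWeight w ε) *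
          (f x * ENNReal.ofReal (kernelDet (indicatorVec ε) ψ n x)) := by
      intro x
      rw [kernelDet_eq_sum, ENNReal.ofReal_sum_of_nonneg fun ε _ => mul_nonneg
        (bernoulliWeight_nonneg hw ε) (kernelDet_nonneg (indicatorVec_nonneg ε) _ _),
        Finset.mul_sum]
      refine Finset.sum_congr rfl fun ε _ => ?_
      rw [ENNReal.ofReal_mul (bernoulliWeight_nonneg hw ε)]
      ring
    have hfk : ∀ ε, Measurable fun x =>
        f x * ENNReal.ofReal (kernelDet (indicatorVec ε) ψ n x) := fun ε => hf.mul (hkm ε)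
    rw [lintegral_congr h, lintegral_finsetSum _ fun ε _ => (hfk ε).const_mul _]
    exact Finset.sum_congr rfl fun ε _ => (lintegral_const_mul _ (hfk ε)).symm

end Existence

/-! ### Uniqueness of the determinantal processes -/

section Uniqueness

variable {Ω : Type*} [MeasurableSpace Ω]

/-- The law of a point process with a bounded number of points is determined by its correlation
measures: the part of the law on configurations of cardinality `k` is obtained from the `k`-th
correlation measure by removing the contributions of larger cardinalities. -/
lemma ext_of_lintegral_sumDistinct {μ₁ μ₂ : Measure (Multiset Ω)} [IsFiniteMeasure μ₁]
    [IsFiniteMeasure μ₂] {p : ℕ} (h₁ : ∀ᵐ s ∂μ₁, s.card ≤ p) (h₂ : ∀ᵐ s ∂μ₂, s.card ≤ p)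
    (h : ∀ (n : ℕ) (f : (Fin n → Ω) → ℝ≥0∞), Measurable f →
      ∫⁻ s, sumDistinct f s ∂μ₁ = ∫⁻ s, sumDistinct f s ∂μ₂) : μ₁ = μ₂ := by
  have hsum : ∀ μ : Measure (Multiset Ω),
      Measure.sum (fun k : ℕ => μ.restrict {s | s.card = k}) = μ := fun μ =>
    sum_restrict_fiber μ measurable_card
  -- Descending induction on the cardinality `k`, which starts above `p`.
  suffices H : ∀ d k, p < k + d →
      μ₁.restrict {s | s.card = k} = μ₂.restrict {s | s.card = k} by
    rw [← hsum μ₁, ← hsum μ₂]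
    exact congrArg _ (funext fun k => H (p + 1) k (by omega))
  intro d
  induction d with
  | zero =>
    intro k hk
    have h0 : ∀ μ : Measure (Multiset Ω), (∀ᵐ s ∂μ, s.card ≤ p) →
        μ.restrict {s | s.card = k} = 0 := by
      intro μ hμ
      rw [Measure.restrict_eq_zero]
      refine measure_mono_null (fun s hs => ?_) hμ
      have : s.card = k := hs
      change ¬ s.card ≤ p
      omega
    rw [h0 _ h₁, h0 _ h₂]
  | succ d ih =>
    intro k hk
    ext T hT
    let g : Multiset Ω → ℝ≥0∞ := T.indicator 1
    have hg : Measurable g := measurable_one.indicator hT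
    let f : (Fin k → Ω) → ℝ≥0∞ := fun x => g (config x)
    have hf : Measurable f := hg.comp measurable_config
    have hsplit : ∀ μ : Measure (Multiset Ω), ∫⁻ s, sumDistinct f s ∂μ =
        k.factorial * μ.restrict {s | s.card = k} T +
          ∑' j, if j = k then 0 else ∫⁻ s in {s | s.card = j}, sumDistinct f s ∂μ := by
      intro μ
      conv_lhs => rw [← hsum μ, lintegral_sum_measure, ENNReal.tsum_eq_add_tsum_ite k]
      refine congrArg₂ (· + ·) ?_ (tsum_congr fun j => by congr)
      have : ∀ᵐ s ∂(μ.restrict {s | s.card = k}), sumDistinct f s = k.factorial * g s := by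
        filter_upwards [ae_restrict_mem (measurableSet_card_eq k)] with s hs
        exact sumDistinct_comp_config g hs
      rw [lintegral_congr_ae this, lintegral_const_mul _ hg, lintegral_indicator_one hT]
    have hfin : ∫⁻ s, sumDistinct f s ∂μ₁ ≠ ∞ := by
      refine ne_top_of_le_ne_top (b := ∫⁻ _, (p ^ k : ℕ) ∂μ₁) ?_ (lintegral_mono_ae ?_)
      · rw [lintegral_const]
        exact ENNReal.mul_ne_top (ENNReal.natCast_ne_top _) (measure_ne_top _ _)
      · filter_upwards [h₁] with s hs
        refine le_trans (b := sumDistinct (fun _ : Fin k → Ω => 1) s) ?_ ?_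
        · refine Finset.sum_le_sum fun e _ => ?_
          exact Set.indicator_le_self' (fun _ _ => zero_le_one) _
        · rw [sumDistinct_one]
          exact_mod_cast (Nat.descFactorial_le_pow _ _).trans (Nat.pow_le_pow_left hs k)
    -- There is no contribution of smaller cardinalities, and that of larger ones is known.
    have hrest : ∀ j, (if j = k then 0 else ∫⁻ s in {s | s.card = j}, sumDistinct f s ∂μ₁) =
        if j = k then 0 else ∫⁻ s in {s | s.card = j}, sumDistinct f s ∂μ₂ := by
      intro j
      split_ifs with hj
      · rfl
      obtain hlt | hgt := lt_or_gt_of_ne hj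
      · have h0 : ∀ μ : Measure (Multiset Ω),
            ∫⁻ s in {s | s.card = j}, sumDistinct f s ∂μ = 0 := by
          intro μ
          have : ∀ᵐ s ∂(μ.restrict {s | s.card = j}), sumDistinct f s = 0 := by
            filter_upwards [ae_restrict_mem (measurableSet_card_eq j)] with s hs
            exact sumDistinct_eq_zero (by rw [show s.card = j from hs]; exact hlt)
          rw [lintegral_congr_ae this, lintegral_zero]
        rw [h0, h0]
      · rw [ih j (by omega)]
    have heq := h k f hf
    rw [hsplit] at hfin
    rw [hsplit, hsplit, tsum_congr hrest, ENNReal.add_left_inj (by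
      rw [← tsum_congr hrest]
      exact ne_top_of_le_ne_top hfin le_add_self)] at heq
    exact (ENNReal.mul_right_inj (by positivity) (ENNReal.natCast_ne_top _)).1 heq

variable {p : ℕ} {ν : Measure Ω} [IsFiniteMeasure ν] {ψ : Fin p → Ω → ℝ}

/-- A kernel of rank at most `p` has no more than `p` points, because its correlation function of order
`p + 1` vanishes. -/
lemma ae_card_le_of_isDPP (hψ : ∀ i, MemLp (ψ i) 2 ν)
    (ho : ∀ i j, ∫ x, ψ i x * ψ j x ∂ν = if i = j then 1 else 0) {w : Fin p → ℝ}
    {μ : Measure (Multiset Ω)} (hμ : IsDPP ν (spectralKernel w ψ) μ) :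
    ∀ᵐ s ∂μ, s.card ≤ p := by
  have h := hμ.correlation (p + 1) (fun _ => 1) measurable_const
  have hz : ∀ x : Fin (p + 1) → Ω, kernelDet w ψ (p + 1) x = 0 := by
    intro x
    rw [kernelDet_eq_sum]
    refine Finset.sum_eq_zero fun ε _ => ?_
    rw [kernelDet_indicator_eq_zero hψ ho (Nat.lt_succ_of_le (successes_le ε)), mul_zero]
  change _ = ∫⁻ x, 1 * ENNReal.ofReal (kernelDet w ψ (p + 1) x) ∂_ at h
  simp only [hz, ENNReal.ofReal_zero, mul_zero, lintegral_zero] at h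
  rw [lintegral_eq_zero_iff (measurable_sumDistinct measurable_const)] at h
  filter_upwards [h] with s hs
  rw [sumDistinct_one, Pi.zero_apply, Nat.cast_eq_zero, Nat.descFactorial_eq_zero_iff_lt] at hs
  omega

/-- The determinantal process with kernel `spectralKernel w ψ` is the mixture `dppLaw`. -/
lemma eq_dppLaw_of_isDPP (hψm : ∀ i, Measurable (ψ i)) (hψ : ∀ i, MemLp (ψ i) 2 ν)
    (ho : ∀ i j, ∫ x, ψ i x * ψ j x ∂ν = if i = j then 1 else 0) {w : Fin p → ℝ}
    (hw : ∀ i, w i ∈ unitInterval) {μ : Measure (Multiset Ω)}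
    (hμ : IsDPP ν (spectralKernel w ψ) μ) : μ = dppLaw ν ψ w := by
  have h := isDPP_dppLaw hψm hψ ho hw
  have := hμ.isProbabilityMeasure
  have := h.isProbabilityMeasure
  refine ext_of_lintegral_sumDistinct (ae_card_le_of_isDPP hψ ho hμ)
    (ae_card_le_of_isDPP hψ ho h) fun n f hf => ?_
  rw [hμ.correlation n f hf, h.correlation n f hf]

end Uniqueness

/-! ### Generating functionals and the Poisson process -/

section PowerSeries

/-- A power series with nonnegative summable coefficients is determined by its values on
`(0, 1]`. -/
lemma eq_of_tsum_mul_pow_eq {a b : ℕ → ℝ≥0∞} (ha : ∑' k, a k ≠ ∞) (hb : ∑' k, b k ≠ ∞)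
    (h : ∀ t : ℝ≥0∞, t ≠ 0 → t ≤ 1 → ∑' k, a k * t ^ k = ∑' k, b k * t ^ k) (m : ℕ) :
    a m = b m := by
  -- Splitting off the constant term of the series shifted by `m`.
  have hstep : ∀ (c : ℕ → ℝ≥0∞) (m : ℕ) (t : ℝ≥0∞), ∑' k, c (k + m) * t ^ k =
      c m + t * ∑' k, c (k + (m + 1)) * t ^ k := by
    intro c m t
    rw [tsum_eq_zero_add' ENNReal.summable, ← ENNReal.tsum_mul_left]
    · simp only [zero_add, pow_zero, mul_one]
      congr 1
      refine tsum_congr fun k => ?_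
      rw [pow_succ, add_right_comm, add_assoc]
      ring
  -- Letting `t = 1 / (n + 1)` tend to `0` compares the constant terms.
  have hle : ∀ {c d : ℕ → ℝ≥0∞} {m : ℕ}, ∑' k, d k ≠ ∞ →
      (∀ t : ℝ≥0∞, t ≠ 0 → t ≤ 1 → ∑' k, c (k + m) * t ^ k = ∑' k, d (k + m) * t ^ k) →
      c m ≤ d m := by
    intro c d m hd hcd
    have hb : ∀ n : ℕ, c m ≤ d m + ((n + 1 : ℕ) : ℝ≥0∞)⁻¹ * ∑' k, d k := by
      intro n
      have ht1 : ((n + 1 : ℕ) : ℝ≥0∞)⁻¹ ≤ 1 := ENNReal.inv_le_one.2 (by simp)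
      have h1 := hcd ((n + 1 : ℕ) : ℝ≥0∞)⁻¹ (by simp) ht1
      rw [hstep c, hstep d] at h1
      refine (le_self_add.trans h1.le).trans ?_
      refine add_le_add le_rfl (mul_le_mul' le_rfl ?_)
      calc ∑' k, d (k + (m + 1)) * (((n + 1 : ℕ) : ℝ≥0∞)⁻¹) ^ k
          ≤ ∑' k, d (k + (m + 1)) := ENNReal.tsum_le_tsum fun k =>
            mul_le_of_le_one_right' (pow_le_one₀ zero_le ht1)
        _ ≤ ∑' k, d k := ENNReal.tsum_comp_le_tsum_of_injective (add_left_injective _) d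
    have hlim : Filter.Tendsto (fun n : ℕ => d m + ((n + 1 : ℕ) : ℝ≥0∞)⁻¹ * ∑' k, d k)
        Filter.atTop (nhds (d m + 0 * ∑' k, d k)) :=
      tendsto_const_nhds.add (ENNReal.Tendsto.mul_const
        (ENNReal.tendsto_inv_nat_nhds_zero.comp (Filter.tendsto_add_atTop_nat 1)) (Or.inr hd))
    rw [zero_mul, add_zero] at hlim
    exact ge_of_tendsto' hlim hb
  have hfin : ∀ (c : ℕ → ℝ≥0∞) (m : ℕ), ∑' k, c k ≠ ∞ → c m ≠ ∞ := fun c m hc =>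
    ENNReal.ne_top_of_tsum_ne_top hc m
  have key : ∀ m (t : ℝ≥0∞), t ≠ 0 → t ≤ 1 →
      ∑' k, a (k + m) * t ^ k = ∑' k, b (k + m) * t ^ k := by
    intro m
    induction m with
    | zero => simpa using h
    | succ m ih =>
      intro t ht ht1
      have heq : a m = b m :=
        le_antisymm (hle hb ih) (hle ha fun t ht ht1 => (ih t ht ht1).symm)
      have h1 := ih t ht ht1
      rw [hstep a, hstep b, heq, ENNReal.add_right_inj (hfin b m hb)] at h1
      exact (ENNReal.mul_right_inj ht (ne_top_of_le_ne_top ENNReal.one_ne_top ht1)).1 h1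
  exact le_antisymm (hle hb (key m)) (hle ha fun t ht ht1 => (key m t ht ht1).symm)

end PowerSeries

section GeneratingFunctional

variable {Ω : Type*} [MeasurableSpace Ω]

/-- The generating functional of a point process: the expectation of the product of the values of
`h` at the points. -/
def genFun (μ : Measure (Multiset Ω)) (h : SimpleFunc Ω ℝ≥0∞) : ℝ≥0∞ :=
  ∫⁻ s, (s.map h).prod ∂μ

lemma prod_map_mul_piecewise (h : SimpleFunc Ω ℝ≥0∞) {B : Set Ω} (hB : MeasurableSet B)
    (t : ℝ≥0∞) (s : Multiset Ω) :
    (s.map (h * SimpleFunc.piecewise B hB (SimpleFunc.const Ω t) (SimpleFunc.const Ω 1) :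
      SimpleFunc Ω ℝ≥0∞)).prod = (s.map h).prod * t ^ count B s := by
  classical
  induction s using Multiset.induction_on with
  | empty => simp [count]
  | cons a s ih =>
    rw [Multiset.map_cons, Multiset.prod_cons, ih, Multiset.map_cons, Multiset.prod_cons, count,
      count, Multiset.countP_cons]
    by_cases ha : a ∈ B
    · simp [ha, pow_succ]
      ring
    · simp [ha]
      ring

lemma genFun_le (μ : Measure (Multiset Ω)) {h : SimpleFunc Ω ℝ≥0∞} (h1 : ∀ x, h x ≤ 1) :
    genFun μ h ≤ μ Set.univ := by
  rw [← lintegral_one]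
  refine lintegral_mono fun s => ?_
  induction s using Multiset.induction_on with
  | empty => simp
  | cons a s ih => simpa using mul_le_one' (h1 a) ih

lemma measurableSet_count_eq {B : Set Ω} (hB : MeasurableSet B) (k : ℕ) :
    MeasurableSet {s | count B s = k} :=
  measurable_count hB (measurableSet_singleton k)

/-- Equality of the generating functionals passes to the events that a given set has `k` points:
multiplying `h` by `t` on `B` turns the generating functional into a power series in `t` whose
coefficients are the generating functionals on these events. -/
lemma genFun_restrict_eq {μ₁ μ₂ : Measure (Multiset Ω)} [IsFiniteMeasure μ₁] [IsFiniteMeasure μ₂]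
    (h : ∀ h : SimpleFunc Ω ℝ≥0∞, (∀ x, h x ≤ 1) → genFun μ₁ h = genFun μ₂ h) {B : Set Ω}
    (hB : MeasurableSet B) (k : ℕ) (g : SimpleFunc Ω ℝ≥0∞) (hg : ∀ x, g x ≤ 1) :
    genFun (μ₁.restrict {s | count B s = k}) g = genFun (μ₂.restrict {s | count B s = k}) g := by
  have hsplit : ∀ (μ : Measure (Multiset Ω)) (t : ℝ≥0∞), t ≤ 1 →
      genFun μ (g * SimpleFunc.piecewise B hB (SimpleFunc.const Ω t) (SimpleFunc.const Ω 1)) =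
        ∑' k, genFun (μ.restrict {s | count B s = k}) g * t ^ k := by
    intro μ t ht
    rw [genFun]
    conv_lhs => rw [← sum_restrict_fiber μ (measurable_count hB), lintegral_sum_measure]
    refine tsum_congr fun k => ?_
    have : ∀ᵐ s ∂(μ.restrict {s | count B s = k}), (s.map (g * SimpleFunc.piecewise B hB
        (SimpleFunc.const Ω t) (SimpleFunc.const Ω 1) : SimpleFunc Ω ℝ≥0∞)).prod =
        (s.map g).prod * t ^ k := by
      filter_upwards [ae_restrict_mem (measurableSet_count_eq hB k)] with s hs
      rw [prod_map_mul_piecewise, show count B s = k from hs]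
    rw [lintegral_congr_ae this, lintegral_mul_const' _ _
      (ENNReal.pow_ne_top (ne_top_of_le_ne_top ENNReal.one_ne_top ht)), genFun]
  have hfin : ∀ (μ : Measure (Multiset Ω)) [IsFiniteMeasure μ],
      ∑' k, genFun (μ.restrict {s | count B s = k}) g ≠ ∞ := by
    intro μ _
    have h1 := hsplit μ 1 le_rfl
    simp only [one_pow, mul_one] at h1
    rw [← h1]
    refine ne_top_of_le_ne_top (measure_ne_top μ Set.univ) (genFun_le μ fun x => ?_)
    simp [hg x]
  refine eq_of_tsum_mul_pow_eq (hfin μ₁) (hfin μ₂) (fun t _ ht => ?_) k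
  rw [← hsplit μ₁ t ht, ← hsplit μ₂ t ht]
  refine h _ fun x => ?_
  by_cases hx : x ∈ B
  · simpa [hx] using mul_le_one' (hg x) ht
  · simpa [hx] using hg x

/-- The law of a point process is determined by its generating functional. The counts of finitely
many sets are conditioned upon one at a time, reading off the coefficients of a power series. -/
lemma ext_of_genFun {μ₁ μ₂ : Measure (Multiset Ω)} [IsFiniteMeasure μ₁] [IsFiniteMeasure μ₂]
    (h : ∀ h : SimpleFunc Ω ℝ≥0∞, (∀ x, h x ≤ 1) → genFun μ₁ h = genFun μ₂ h) : μ₁ = μ₂ := by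
  -- The events that prescribe finitely many counts form a generating π-system.
  let E : List ({B : Set Ω // MeasurableSet B} × ℕ) → Set (Multiset Ω) := fun l =>
    {s | ∀ q ∈ l, count q.1.1 s = q.2}
  have huniv : ∀ {μ₁ μ₂ : Measure (Multiset Ω)},
      (∀ h : SimpleFunc Ω ℝ≥0∞, (∀ x, h x ≤ 1) → genFun μ₁ h = genFun μ₂ h) →
      μ₁ Set.univ = μ₂ Set.univ := by
    intro μ₁ μ₂ h
    simpa [genFun] using h 1 fun x => le_rfl
  have hE : ∀ l, MeasurableSet (E l) ∧ ∀ {μ₁ μ₂ : Measure (Multiset Ω)} [IsFiniteMeasure μ₁]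
      [IsFiniteMeasure μ₂],
      (∀ h : SimpleFunc Ω ℝ≥0∞, (∀ x, h x ≤ 1) → genFun μ₁ h = genFun μ₂ h) →
      μ₁ (E l) = μ₂ (E l) := by
    intro l
    induction l with
    | nil => exact ⟨by simp [E], fun h => by simpa [E] using huniv h⟩
    | cons q l ih =>
      have hq := measurableSet_count_eq q.1.2 q.2
      have hcons : E (q :: l) = E l ∩ {s | count q.1.1 s = q.2} := by
        ext s
        exact List.forall_mem_cons.trans and_comm
      rw [hcons]
      refine ⟨ih.1.inter hq, fun {μ₁ μ₂} _ _ h => ?_⟩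
      rw [← Measure.restrict_apply ih.1, ← Measure.restrict_apply ih.1]
      exact ih.2 (genFun_restrict_eq h q.1.2 q.2)
  refine ext_of_generate_finite (Set.range E) (le_antisymm ?_ ?_) ?_ ?_ (huniv h)
  · refine iSup₂_le fun B hB => ?_
    rw [← measurable_iff_comap_le]
    refine @measurable_to_countable' _ _ _ _ (MeasurableSpace.generateFrom (Set.range E)) _
      fun k => MeasurableSpace.measurableSet_generateFrom ⟨[(⟨B, hB⟩, k)], ?_⟩
    ext s
    exact List.forall_mem_singleton
  · refine MeasurableSpace.generateFrom_le ?_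
    rintro _ ⟨l, rfl⟩
    exact (hE l).1
  · rintro _ ⟨l, rfl⟩ _ ⟨l', rfl⟩ -
    refine ⟨l ++ l', ?_⟩
    ext s
    simp only [E, List.mem_append, Set.mem_ofPred_eq, Set.mem_inter_iff]
    exact ⟨fun H => ⟨fun q hq => H q (Or.inl hq), fun q hq => H q (Or.inr hq)⟩,
      fun H q hq => hq.elim (H.1 q) (H.2 q)⟩
  · rintro _ ⟨l, rfl⟩
    exact (hE l).2 h

end GeneratingFunctional

section Poisson

variable {Ω : Type*} [MeasurableSpace Ω]

/-- The law of the Poisson process with intensity `ν`, as a mixture over the number of points. -/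
def poissonLaw (ν : Measure Ω) : Measure (Multiset Ω) :=
  Measure.sum fun n : ℕ => (ENNReal.ofReal (Real.exp (-ν.real Set.univ)) *
    (n.factorial : ℝ≥0∞)⁻¹) • (Measure.pi fun _ : Fin n => ν).map config

lemma lintegral_pi_prod (ν : Measure Ω) [SigmaFinite ν] {h : Ω → ℝ≥0∞} (hh : Measurable h) (n : ℕ) :
    ∫⁻ x : Fin n → Ω, ∏ i, h (x i) ∂(Measure.pi fun _ => ν) = (∫⁻ z, h z ∂ν) ^ n := by
  have hm : ∀ n, Measurable fun x : Fin n → Ω => ∏ i, h (x i) := fun n =>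
    Finset.measurable_prod _ fun i _ => hh.comp (measurable_pi_apply i)
  induction n with
  | zero => simp
  | succ n ih =>
    rw [lintegral_pi_succ ν (hm _)]
    simp only [Fin.prod_univ_succ, Fin.cons_zero, Fin.cons_succ]
    simp_rw [lintegral_mul_const _ hh]
    rw [lintegral_const_mul _ (hm n), ih, pow_succ']

lemma tsum_ofReal_exp_mul_pow (r : ℝ) {v : ℝ} (hv : 0 ≤ v) :
    ∑' n : ℕ, ENNReal.ofReal (Real.exp (-r) * v ^ n / n.factorial) =
      ENNReal.ofReal (Real.exp (v - r)) := by
  have hs : HasSum (fun n : ℕ => Real.exp (-r) * v ^ n / n.factorial) (Real.exp (v - r)) := by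
    have := (NormedSpace.expSeries_div_hasSum_exp v).mul_left (Real.exp (-r))
    rw [← Real.exp_eq_exp_ℝ, ← Real.exp_add, neg_add_eq_sub] at this
    simpa only [mul_div_assoc] using this
  rw [← ENNReal.ofReal_tsum_of_nonneg (fun n => by positivity) hs.summable, hs.tsum_eq]

lemma prod_map_simpleFunc (h : SimpleFunc Ω ℝ≥0∞) (s : Multiset Ω) :
    (s.map h).prod = ∏ v : h.range, (v : ℝ≥0∞) ^ count (h ⁻¹' {(v : ℝ≥0∞)}) s := by
  classical
  induction s using Multiset.induction_on with
  | empty => simp [count]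
  | cons a s ih =>
    have hc : ∀ v : h.range, (v : ℝ≥0∞) ^ count (h ⁻¹' {(v : ℝ≥0∞)}) (a ::ₘ s) =
        (v : ℝ≥0∞) ^ count (h ⁻¹' {(v : ℝ≥0∞)}) s *
          if v = ⟨h a, SimpleFunc.mem_range_self h a⟩ then (v : ℝ≥0∞) else 1 := by
      intro v
      rw [count, count, Multiset.countP_cons]
      by_cases hv : h a = v
      · simp [hv, pow_succ]
      · have : v ≠ ⟨h a, SimpleFunc.mem_range_self h a⟩ := fun h' => hv (by rw [h'])
        simp [hv, this]
    rw [Multiset.map_cons, Multiset.prod_cons, ih, Finset.prod_congr rfl fun v _ => hc v,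
      Finset.prod_mul_distrib, Finset.prod_ite_eq' Finset.univ, mul_comm]
    simp

lemma genFun_poissonLaw (ν : Measure Ω) [IsFiniteMeasure ν] {h : SimpleFunc Ω ℝ≥0∞}
    (h1 : ∀ x, h x ≤ 1) : genFun (poissonLaw ν) h =
      ENNReal.ofReal (Real.exp ((∫⁻ x, h x ∂ν).toReal - ν.real Set.univ)) := by
  have hm : Measurable fun s : Multiset Ω => (s.map h).prod := by
    simp only [prod_map_simpleFunc]
    refine Finset.measurable_prod _ fun v _ => ?_
    exact (measurable_from_top (f := fun k : ℕ => (v : ℝ≥0∞) ^ k)).comp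
      (measurable_count (h.measurableSet_fiber _))
  have hfin : ∫⁻ x, h x ∂ν ≠ ∞ := by
    refine ne_top_of_le_ne_top (measure_ne_top ν Set.univ) ?_
    rw [← lintegral_one]
    exact lintegral_mono h1
  rw [genFun, poissonLaw, lintegral_sum_measure,
    ← tsum_ofReal_exp_mul_pow _ ENNReal.toReal_nonneg]
  refine tsum_congr fun n => ?_
  rw [lintegral_smul_measure, lintegral_map hm measurable_config]
  simp only [prod_map_config]
  rw [lintegral_pi_prod ν h.measurable, mul_div_right_comm, ENNReal.ofReal_mul (by positivity),
    ENNReal.ofReal_pow ENNReal.toReal_nonneg, ENNReal.ofReal_toReal hfin, div_eq_mul_inv,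
    ENNReal.ofReal_mul (by positivity), ENNReal.ofReal_inv_of_pos (by positivity),
    ENNReal.ofReal_natCast, smul_eq_mul]

instance isProbabilityMeasure_poissonLaw (ν : Measure Ω) [IsFiniteMeasure ν] :
    IsProbabilityMeasure (poissonLaw ν) := by
  have h := genFun_poissonLaw ν (h := 1) fun x => le_rfl
  refine ⟨?_⟩
  simpa [genFun, Measure.real] using h

lemma lintegral_pow_poissonMeasure (r : ℝ≥0) {v : ℝ≥0∞} (hv : v ≤ 1) :
    ∫⁻ n, v ^ n ∂(poissonMeasure r) = ENNReal.ofReal (Real.exp (r * v.toReal - r)) := by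
  have hv' : v ≠ ∞ := ne_top_of_le_ne_top ENNReal.one_ne_top hv
  rw [poissonMeasure, lintegral_sum_measure,
    ← tsum_ofReal_exp_mul_pow _ (v := r * v.toReal) (by positivity)]
  refine tsum_congr fun n => ?_
  rw [lintegral_smul_measure, lintegral_dirac, smul_eq_mul]
  conv_lhs => rw [← ENNReal.ofReal_toReal hv', ← ENNReal.ofReal_pow ENNReal.toReal_nonneg,
    ← ENNReal.ofReal_mul (by positivity)]
  congr 1
  rw [mul_pow]
  ring

/-- The points contribute the product, over the finitely many values of `h`, of independent powers with
Poisson exponents. -/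
lemma genFun_of_isPoissonProcess {ν : Measure Ω} [IsFiniteMeasure ν] {μ : Measure (Multiset Ω)}
    (hμ : IsPoissonProcess ν μ) {h : SimpleFunc Ω ℝ≥0∞} (h1 : ∀ x, h x ≤ 1) :
    genFun μ h = ENNReal.ofReal (Real.exp ((∫⁻ x, h x ∂ν).toReal - ν.real Set.univ)) := by
  let e := h.range.equivFin.symm
  let B : Fin h.range.card → Set Ω := fun i => h ⁻¹' {(e i : ℝ≥0∞)}
  have hB : ∀ i, MeasurableSet (B i) := fun i => h.measurableSet_fiber _
  have hdis : Pairwise fun i j => Disjoint (B i) (B j) := by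
    intro i j hij
    refine Set.disjoint_left.2 fun x hi hj => hij (e.injective (Subtype.ext ?_))
    exact (show h x = e i from hi).symm.trans hj
  have hle : ∀ i, (e i : ℝ≥0∞) ≤ 1 := by
    intro i
    obtain ⟨x, hx⟩ := SimpleFunc.mem_range.1 (e i).2
    exact hx ▸ h1 x
  have hfin : ∀ i, (e i : ℝ≥0∞) ≠ ∞ := fun i => ne_top_of_le_ne_top ENNReal.one_ne_top (hle i)
  have hind := (hμ.count_indep _ B hB hdis).comp (fun i k => (e i : ℝ≥0∞) ^ k)
    fun i => measurable_from_top
  have hprod : ∀ s : Multiset Ω, (s.map h).prod =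
      ∏ i, ((fun k => (e i : ℝ≥0∞) ^ k) ∘ count (B i)) s := by
    intro s
    rw [prod_map_simpleFunc, ← e.prod_comp]
    rfl
  have hint : ∫⁻ x, h x ∂ν = ∑ i, (e i : ℝ≥0∞) * ν (B i) := by
    rw [SimpleFunc.lintegral_eq_lintegral, SimpleFunc.lintegral, ← Finset.sum_coe_sort,
      ← e.sum_comp]
  have hone : ν.real Set.univ = ∑ i, ν.real (B i) := by
    have hU : (⋃ i, B i) = Set.univ := by
      refine Set.eq_univ_of_forall fun x => Set.mem_iUnion.2
        ⟨e.symm ⟨h x, SimpleFunc.mem_range_self h x⟩, ?_⟩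
      simp [B]
    rw [measureReal_def, ← hU, measure_iUnion hdis hB, tsum_fintype,
      ENNReal.toReal_sum fun i _ => measure_ne_top _ _]
    rfl
  rw [genFun, lintegral_congr hprod, lintegral_prod_eq_prod_lintegral_of_indepFun _ _ hind
    fun i => (measurable_from_top.comp (measurable_count (hB i)))]
  have hi : ∀ i, ∫⁻ s, ((fun k => (e i : ℝ≥0∞) ^ k) ∘ count (B i)) s ∂μ =
      ENNReal.ofReal (Real.exp (ν.real (B i) * (e i : ℝ≥0∞).toReal - ν.real (B i))) := by
    intro i
    have := lintegral_map (μ := μ) (f := fun k : ℕ => (e i : ℝ≥0∞) ^ k) measurable_from_top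
      (measurable_count (hB i))
    rw [hμ.count_law _ (hB i), lintegral_pow_poissonMeasure _ (hle i)] at this
    exact this.symm
  rw [Finset.prod_congr rfl fun i _ => hi i, ← ENNReal.ofReal_prod_of_nonneg fun i _ =>
    (Real.exp_pos _).le, ← Real.exp_sum, Finset.sum_sub_distrib, hone, hint,
    ENNReal.toReal_sum fun i _ => ENNReal.mul_ne_top (hfin i) (measure_ne_top _ _)]
  simp [ENNReal.toReal_mul, Measure.real, mul_comm]

lemma eq_poissonLaw_of_isPoissonProcess {ν : Measure Ω} [IsFiniteMeasure ν]
    {μ : Measure (Multiset Ω)} (hμ : IsPoissonProcess ν μ) : μ = poissonLaw ν := by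
  have := hμ.isProbabilityMeasure
  exact ext_of_genFun fun h h1 => by rw [genFun_of_isPoissonProcess hμ h1, genFun_poissonLaw ν h1]

lemma pi_smul_const (ν : Measure Ω) [IsFiniteMeasure ν] (n : ℕ) {c : ℝ≥0∞} (hc : c ≠ ∞) :
    (Measure.pi fun _ : Fin n => c • ν) = c ^ n • Measure.pi fun _ : Fin n => ν := by
  have : IsFiniteMeasure (c • ν) := ν.smul_finite hc
  refine Measure.pi_eq fun s _ => ?_
  simp [Measure.pi_pi, Finset.prod_mul_distrib]

/-- Conditionally on its number of points, a Poisson process consists of independent points. -/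
lemma poissonMeasure_smul_iidLaw (ν : Measure Ω) [IsFiniteMeasure ν] (n : ℕ) :
    poissonMeasure (ν Set.univ).toNNReal {n} • iidLaw ν n =
      (ENNReal.ofReal (Real.exp (-ν.real Set.univ)) * (n.factorial : ℝ≥0∞)⁻¹) •
        (Measure.pi fun _ : Fin n => ν).map config := by
  have hr : ((ν Set.univ).toNNReal : ℝ) = ν.real Set.univ := rfl
  rw [poissonMeasure_singleton, hr, mul_div_right_comm, div_eq_mul_inv,
    ENNReal.ofReal_mul (by positivity), ENNReal.ofReal_mul (by positivity),
    ENNReal.ofReal_inv_of_pos (by positivity), ENNReal.ofReal_natCast,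
    ENNReal.ofReal_pow measureReal_nonneg, ofReal_measureReal, iidLaw]
  -- If `ν = 0`, then `iidLaw ν n` is built from `∞ • 0 = 0` and vanishes for `n ≠ 0`, but then its
  -- Poisson weight vanishes as well.
  obtain rfl | hν := eq_or_ne ν 0
  · cases n with
    | zero =>
      have : ∀ ν' : Measure Ω, (Measure.pi fun _ : Fin 0 => ν') = Measure.dirac isEmptyElim :=
        fun ν' => Measure.pi_of_empty _
      simp [this]
    | succ n =>
      have : (Measure.pi fun _ : Fin (n + 1) => (0 : Measure Ω)) = 0 := by
        rw [← Measure.measure_univ_eq_zero, Measure.pi_univ]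
        simp
      simp [this]
  · have h0 : ν Set.univ ≠ 0 := by simpa using hν
    rw [pi_smul_const ν n (ENNReal.inv_ne_top.2 h0), Measure.map_smul, smul_smul, mul_assoc,
      ← mul_pow, ENNReal.mul_inv_cancel h0 (measure_ne_top _ _), one_pow, mul_one]

end Poisson

/-! ### Superposition with a Poisson process -/

section Superposition

variable {Ω : Type*}

lemma config_eq_sum {n : ℕ} (x : Fin n → Ω) : config x = ∑ i, ({x i} : Multiset Ω) := by
  rw [← sum_map_config (fun a => ({a} : Multiset Ω)), Multiset.sum_map_singleton]

variable [MeasurableSpace Ω]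

/-- The law of the superposition of two independent point processes. -/
def superposition (μ₁ μ₂ : Measure (Multiset Ω)) : Measure (Multiset Ω) :=
  (μ₁.prod μ₂).map fun s => s.1 + s.2

lemma lintegral_superposition (μ₁ μ₂ : Measure (Multiset Ω)) [SFinite μ₂]
    {F : Multiset Ω → ℝ≥0∞} (hF : Measurable F) :
    ∫⁻ s, F s ∂(superposition μ₁ μ₂) = ∫⁻ s, ∫⁻ t, F (s + t) ∂μ₂ ∂μ₁ := by
  rw [superposition, lintegral_map hF measurable_superposition]
  exact lintegral_prod _ (hF.comp measurable_superposition).aemeasurable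

lemma superposition_sum_left {ι : Type*} [Fintype ι] (c : ι → ℝ≥0∞) (μ : ι → Measure (Multiset Ω))
    (μ' : Measure (Multiset Ω)) [SFinite μ'] :
    superposition (∑ i, c i • μ i) μ' = ∑ i, c i • superposition (μ i) μ' := by
  refine Measure.ext_of_lintegral _ fun F hF => ?_
  simp only [lintegral_superposition _ _ hF, lintegral_finsetSum_measure, lintegral_smul_measure]

lemma superposition_sum_right (μ : Measure (Multiset Ω)) (c : ℕ → ℝ≥0∞)
    (μ' : ℕ → Measure (Multiset Ω)) [∀ n, SFinite (μ' n)] [SFinite μ] :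
    superposition μ (Measure.sum fun n => c n • μ' n) =
      Measure.sum fun n => c n • superposition μ (μ' n) := by
  rw [superposition, Measure.prod_sum_right, Measure.map_sum measurable_superposition.aemeasurable]
  refine congrArg _ (funext fun n => ?_)
  rw [Measure.prod_smul_right, Measure.map_smul, superposition]

/-- Distinguishing `N` of the `n` points of a configuration. -/
lemma lintegral_config_mul_comp_embedding (ν : Measure Ω) [IsFiniteMeasure ν] {N m n : ℕ}
    (hn : n = N + m) (e : Fin N ↪ Fin n) {F : Multiset Ω → ℝ≥0∞} (hF : Measurable F)
    {g : (Fin N → Ω) → ℝ≥0∞} (hg : Measurable g) :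
    ∫⁻ x : Fin n → Ω, F (config x) * g (fun i => x (e i)) ∂(Measure.pi fun _ => ν) =
      ∫⁻ y : Fin N → Ω, ∫⁻ z : Fin m → Ω, F (config y + config z) * g y
        ∂(Measure.pi fun _ => ν) ∂(Measure.pi fun _ => ν) := by
  classical
  have hcard : Fintype.card ((Set.range e)ᶜ : Set (Fin n)) = m := by
    rw [Fintype.card_compl_set, Fintype.card_fin, ← Fintype.card_congr
      (Equiv.ofInjective e e.injective), Fintype.card_fin]
    omega
  let σ : Fin N ⊕ Fin m ≃ Fin n :=
    (Equiv.sumCongr (Equiv.ofInjective e e.injective) (Fintype.equivFinOfCardEq hcard).symm).trans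
      (Equiv.Set.sumCompl (Set.range e))
  have hσ : ∀ i, σ (Sum.inl i) = e i := fun i => rfl
  have hmp := (measurePreserving_sumPiEquivProdPi (X := fun _ : Fin N ⊕ Fin m => Ω)
    fun _ => ν).comp (measurePreserving_comp_equiv ν σ)
  have hmeas : Measurable fun q : (Fin N → Ω) × (Fin m → Ω) =>
      F (config q.1 + config q.2) * g q.1 :=
    (hF.comp (measurable_superposition.comp ((measurable_config.comp measurable_fst).prodMk
      (measurable_config.comp measurable_snd)))).mul (hg.comp measurable_fst)
  have hx : ∀ x : Fin n → Ω, F (config x) * g (fun i => x (e i)) =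
      (fun q : (Fin N → Ω) × (Fin m → Ω) => F (config q.1 + config q.2) * g q.1)
        ((MeasurableEquiv.sumPiEquivProdPi fun _ : Fin N ⊕ Fin m => Ω) (x ∘ σ)) := by
    intro x
    have : config x = config (fun i => x (σ (Sum.inl i))) + config fun i => x (σ (Sum.inr i)) := by
      rw [config_eq_sum, config_eq_sum, config_eq_sum, ← σ.sum_comp, Fintype.sum_sum_type]
    rw [this]
    rfl
  rw [lintegral_congr hx]
  exact (hmp.lintegral_comp hmeas).trans (lintegral_prod _ hmeas.aemeasurable)

/-- The Mecke formula, in terms of Janossy measures: a density that sums over the choices of `N` of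
the points amounts to adding `N` points to the process. -/
lemma tsum_lintegral_sum_embedding (ν : Measure Ω) [IsFiniteMeasure ν] {N : ℕ}
    {F : Multiset Ω → ℝ≥0∞} (hF : Measurable F) {g : (Fin N → Ω) → ℝ≥0∞} (hg : Measurable g) :
    ∑' n : ℕ, (n.factorial : ℝ≥0∞)⁻¹ * ∑ e : Fin N ↪ Fin n,
        ∫⁻ x : Fin n → Ω, F (config x) * g (fun i => x (e i)) ∂(Measure.pi fun _ => ν) =
      ∑' m : ℕ, (m.factorial : ℝ≥0∞)⁻¹ * ∫⁻ y : Fin N → Ω, ∫⁻ z : Fin m → Ω,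
        F (config y + config z) * g y ∂(Measure.pi fun _ => ν) ∂(Measure.pi fun _ => ν) := by
  rw [← (add_right_injective N).tsum_eq]
  · refine tsum_congr fun m => ?_
    rw [Finset.sum_congr rfl fun e _ => lintegral_config_mul_comp_embedding ν rfl e hF hg,
      Finset.sum_const, Finset.card_univ, Fintype.card_embedding_eq, Fintype.card_fin,
      Fintype.card_fin, nsmul_eq_mul, ← mul_assoc]
    congr 1
    have h : (N + m).factorial = m.factorial * (N + m).descFactorial N := by
      have := Nat.factorial_mul_descFactorial (Nat.le_add_right N m)
      rwa [Nat.add_sub_cancel_left, eq_comm] at this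
    have hne : (((N + m).descFactorial N : ℕ) : ℝ≥0∞) ≠ 0 := by
      rw [Nat.cast_ne_zero, Ne, Nat.descFactorial_eq_zero_iff_lt]
      omega
    rw [h, Nat.cast_mul, ENNReal.mul_inv (Or.inr (ENNReal.natCast_ne_top _)) (Or.inr hne),
      mul_assoc, ENNReal.inv_mul_cancel hne (ENNReal.natCast_ne_top _), mul_one]
  · intro n hn
    by_contra h
    have hlt : n < N := by
      by_contra hle
      exact h ⟨n - N, by dsimp only; omega⟩
    have : IsEmpty (Fin N ↪ Fin n) := by
      rw [← Fintype.card_eq_zero_iff, Fintype.card_embedding_eq]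
      simpa using hlt
    simp at hn

lemma poissonLaw_eq_sum_iidLaw (ν : Measure Ω) [IsFiniteMeasure ν] :
    poissonLaw ν = Measure.sum fun n =>
      poissonMeasure (ν Set.univ).toNNReal {n} • iidLaw ν n := by
  simp only [poissonMeasure_smul_iidLaw, poissonLaw]

variable {p : ℕ} {ν : Measure Ω} [IsFiniteMeasure ν] {ψ : Fin p → Ω → ℝ}

lemma lintegral_superposition_projectionLaw (hψm : ∀ i, Measurable (ψ i)) (ε : Fin p → Bool)
    {F : Multiset Ω → ℝ≥0∞} (hF : Measurable F) :
    ∫⁻ s, F s ∂(superposition (projectionLaw ν ψ ε) (poissonLaw ν)) =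
      ENNReal.ofReal (Real.exp (-ν.real Set.univ)) * ((successes ε).factorial : ℝ≥0∞)⁻¹ *
        ∑' n : ℕ, (n.factorial : ℝ≥0∞)⁻¹ * ∑ e : Fin (successes ε) ↪ Fin n,
          ∫⁻ x : Fin n → Ω, F (config x) * ENNReal.ofReal
            (kernelDet (indicatorVec ε) ψ _ fun i => x (e i)) ∂(Measure.pi fun _ => ν) := by
  have hk := (measurable_kernelDet (indicatorVec ε) hψm (successes ε)).ennreal_ofReal
  have hFadd : Measurable fun q : Multiset Ω × Multiset Ω => F (q.1 + q.2) :=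
    hF.comp measurable_superposition
  rw [tsum_lintegral_sum_embedding ν hF hk, lintegral_superposition _ _ hF,
    lintegral_projectionLaw ν hψm ε hFadd.lintegral_prod_right']
  have hz : ∀ s : Multiset Ω, ∫⁻ t, F (s + t) ∂(poissonLaw ν) =
      ENNReal.ofReal (Real.exp (-ν.real Set.univ)) * ∑' m : ℕ, (m.factorial : ℝ≥0∞)⁻¹ *
        ∫⁻ z : Fin m → Ω, F (s + config z) ∂(Measure.pi fun _ => ν) := by
    intro s
    have hs : Measurable fun t => F (s + t) := hFadd.comp measurable_prodMk_left
    rw [poissonLaw, lintegral_sum_measure, ← ENNReal.tsum_mul_left]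
    refine tsum_congr fun m => ?_
    rw [lintegral_smul_measure, lintegral_map hs measurable_config, smul_eq_mul, mul_assoc]
  have hin : ∀ m, Measurable fun q : (Fin (successes ε) → Ω) × (Fin m → Ω) =>
      F (config q.1 + config q.2) := fun m =>
    hFadd.comp ((measurable_config.comp measurable_fst).prodMk
      (measurable_config.comp measurable_snd))
  have hy : ∀ y : Fin (successes ε) → Ω, (∫⁻ t, F (config y + t) ∂(poissonLaw ν)) *
      ENNReal.ofReal (kernelDet (indicatorVec ε) ψ _ y) =
      ENNReal.ofReal (Real.exp (-ν.real Set.univ)) * ∑' m : ℕ, (m.factorial : ℝ≥0∞)⁻¹ *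
        ∫⁻ z : Fin m → Ω, F (config y + config z) *
          ENNReal.ofReal (kernelDet (indicatorVec ε) ψ _ y) ∂(Measure.pi fun _ => ν) := by
    intro y
    rw [hz, mul_assoc, ← ENNReal.tsum_mul_right]
    simp_rw [lintegral_mul_const' _ _ ENNReal.ofReal_ne_top, mul_assoc]
  have hm : ∀ m, Measurable fun y : Fin (successes ε) → Ω => ∫⁻ z : Fin m → Ω,
      F (config y + config z) * ENNReal.ofReal (kernelDet (indicatorVec ε) ψ _ y)
        ∂(Measure.pi fun _ => ν) := fun m =>
    Measurable.lintegral_prod_right' (f := fun q : (Fin (successes ε) → Ω) × (Fin m → Ω) =>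
      F (config q.1 + config q.2) * ENNReal.ofReal (kernelDet (indicatorVec ε) ψ _ q.1))
      ((hin m).mul (hk.comp measurable_fst))
  rw [lintegral_congr hy, lintegral_const_mul _ (Measurable.tsum fun m => (hm m).const_mul _),
    lintegral_tsum fun m => ((hm m).const_mul _).aemeasurable]
  simp_rw [lintegral_const_mul _ (hm _)]
  ring

/-- The superposition of a determinantal process of finite rank and a Poisson process, in terms of
Janossy densities. -/
lemma janossyLaw_eq_superposition (hψm : ∀ i, Measurable (ψ i)) {w : Fin p → ℝ}
    (hw : ∀ i, w i ∈ unitInterval) {j : (n : ℕ) → (Fin n → Ω) → ℝ}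
    (hj : ∀ n x, j n x = Real.exp (-ν.real Set.univ) * (1 - Matrix.diagonal w +
      Matrix.diagonal w * ((design ψ x)ᵀ * design ψ x)).det) :
    janossyLaw ν j = superposition (dppLaw ν ψ w) (poissonLaw ν) := by
  have hk : ∀ (ε : Fin p → Bool) (n : ℕ) (e : Fin (successes ε) ↪ Fin n),
      Measurable fun x : Fin n → Ω => ENNReal.ofReal
        (kernelDet (indicatorVec ε) ψ _ fun i => x (e i)) := fun ε n e =>
    (measurable_kernelDet _ hψm _).ennreal_ofReal.comp
      (measurable_pi_lambda _ fun i => measurable_pi_apply _)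
  have hj' : ∀ n x, ENNReal.ofReal (j n x) = ∑ ε, ENNReal.ofReal (bernoulliWeight w ε) *
      (ENNReal.ofReal (Real.exp (-ν.real Set.univ)) * ((successes ε).factorial : ℝ≥0∞)⁻¹ *
        ∑ e : Fin (successes ε) ↪ Fin n, ENNReal.ofReal
          (kernelDet (indicatorVec ε) ψ _ fun i => x (e i))) := by
    intro n x
    -- For each choice of features, the density sums the density of the projection process over the
    -- tuples of distinct points, as in the Mecke formula.
    have hε : ∀ ε : Fin p → Bool, (1 - Matrix.diagonal (indicatorVec ε) +
        Matrix.diagonal (indicatorVec ε) * ((design ψ x)ᵀ * design ψ x)).det =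
        ((successes ε).factorial : ℝ)⁻¹ * ∑ e : Fin (successes ε) ↪ Fin n,
          kernelDet (indicatorVec ε) ψ _ fun i => x (e i) := by
      intro ε
      rw [eq_inv_mul_iff_mul_eq₀ (by positivity), ← sum_det_submatrix_embedding,
        ← of_spectralKernel]
      rfl
    rw [hj, det_one_sub_diagonal_add, Finset.mul_sum, ENNReal.ofReal_sum_of_nonneg]
    · refine Finset.sum_congr rfl fun ε _ => ?_
      rw [hε, mul_left_comm, ENNReal.ofReal_mul (bernoulliWeight_nonneg hw ε),
        ENNReal.ofReal_mul (Real.exp_pos _).le, ENNReal.ofReal_mul (by positivity),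
        ENNReal.ofReal_inv_of_pos (by positivity), ENNReal.ofReal_natCast,
        ENNReal.ofReal_sum_of_nonneg fun e _ => kernelDet_nonneg (indicatorVec_nonneg ε) _ _,
        mul_assoc]
    · intro ε _
      rw [hε]
      have := bernoulliWeight_nonneg hw ε
      have : 0 ≤ ∑ e : Fin (successes ε) ↪ Fin n,
          kernelDet (indicatorVec ε) ψ _ fun i => x (e i) :=
        Finset.sum_nonneg fun e _ => kernelDet_nonneg (indicatorVec_nonneg ε) _ _
      positivity
  have hjm : ∀ n, Measurable fun x => ENNReal.ofReal (j n x) := by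
    intro n
    simp only [hj']
    exact Finset.measurable_sum _ fun ε _ => (Finset.measurable_sum _ fun e _ =>
      hk ε n e).const_mul _ |>.const_mul _
  refine Measure.ext_of_lintegral _ fun F hF => ?_
  rw [dppLaw, superposition_sum_left, lintegral_finsetSum_measure, janossyLaw,
    lintegral_sum_measure]
  simp only [lintegral_smul_measure, lintegral_superposition_projectionLaw hψm _ hF, smul_eq_mul]
  have hFc : ∀ n, Measurable fun x : Fin n → Ω => F (config x) := fun n => hF.comp measurable_config
  have hn : ∀ n : ℕ, ∫⁻ s, F s ∂(((Measure.pi fun _ : Fin n => ν).withDensity fun x =>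
      ENNReal.ofReal (j n x)).map config) = ∑ ε, ENNReal.ofReal (bernoulliWeight w ε) *
      (ENNReal.ofReal (Real.exp (-ν.real Set.univ)) * ((successes ε).factorial : ℝ≥0∞)⁻¹ *
        ∑ e : Fin (successes ε) ↪ Fin n, ∫⁻ x : Fin n → Ω, F (config x) * ENNReal.ofReal
            (kernelDet (indicatorVec ε) ψ _ fun i => x (e i)) ∂(Measure.pi fun _ => ν)) := by
    intro n
    rw [lintegral_map hF measurable_config,
      lintegral_withDensity_eq_lintegral_mul _ (hjm n) (hFc n)]
    have hx : ∀ x : Fin n → Ω, ((fun x : Fin n → Ω => ENNReal.ofReal (j n x)) *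
        fun x : Fin n → Ω => F (config x)) x = ∑ ε, ENNReal.ofReal (bernoulliWeight w ε) *
        (ENNReal.ofReal (Real.exp (-ν.real Set.univ)) * ((successes ε).factorial : ℝ≥0∞)⁻¹ *
        ∑ e : Fin (successes ε) ↪ Fin n, F (config x) * ENNReal.ofReal
          (kernelDet (indicatorVec ε) ψ _ fun i => x (e i))) := by
      intro x
      rw [Pi.mul_apply, hj', Finset.sum_mul]
      refine Finset.sum_congr rfl fun ε _ => ?_
      rw [← Finset.mul_sum]
      ring
    have hFk : ∀ (ε : Fin p → Bool) (e : Fin (successes ε) ↪ Fin n), Measurable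
        fun x : Fin n → Ω => F (config x) * ENNReal.ofReal
          (kernelDet (indicatorVec ε) ψ _ fun i => x (e i)) := fun ε e => (hFc n).mul (hk ε n e)
    have hFs : ∀ ε : Fin p → Bool, Measurable fun x : Fin n → Ω =>
        ∑ e : Fin (successes ε) ↪ Fin n, F (config x) * ENNReal.ofReal
          (kernelDet (indicatorVec ε) ψ _ fun i => x (e i)) := fun ε =>
      Finset.measurable_sum _ fun e _ => hFk ε e
    rw [lintegral_congr hx, lintegral_finsetSum _ fun ε _ => ((hFs ε).const_mul _).const_mul _]
    refine Finset.sum_congr rfl fun ε _ => ?_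
    rw [lintegral_const_mul _ ((hFs ε).const_mul _), lintegral_const_mul _ (hFs ε),
      lintegral_finsetSum _ fun e _ => hFk ε e]
  simp only [hn, Finset.mul_sum]
  rw [Summable.tsum_finsetSum fun ε _ => ENNReal.summable]
  refine Finset.sum_congr rfl fun ε _ => ?_
  rw [← ENNReal.tsum_mul_left, ← ENNReal.tsum_mul_left]
  refine tsum_congr fun n => ?_
  simp only [← Finset.mul_sum]
  ring

end Superposition

/-! ### Conditioning on the number of points -/

section Conditioning

/-- Conditioning a mixture on a statistic that is constant on each component amounts to
conditioning the mixing measure. -/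
lemma bind_cond {α β : Type*} [MeasurableSpace α] [Countable α] [DiscreteMeasurableSpace α]
    [MeasurableSpace β] (Q : Measure α) (κ : α → Measure β) (c : α → ℕ) {C : β → ℕ}
    (hC : Measurable C)
    (hκ : ∀ q, Q {q} ≠ 0 → κ q Set.univ = 1 ∧ ∀ᵐ b ∂(κ q), C b = c q) (k : ℕ) :
    (Q.bind κ) {b | C b = k} = Q {q | c q = k} ∧
      (Q[|{q | c q = k}]).bind κ = (Q.bind κ)[|{b | C b = k}] := by
  have hS : MeasurableSet {b | C b = k} := hC (measurableSet_singleton k)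
  have hT : MeasurableSet {q | c q = k} := MeasurableSet.of_discrete
  have hκm : Measurable κ := .of_discrete
  -- Each component is supported either in the event or in its complement.
  have hrestrict : (Q.restrict {q | c q = k}).bind κ = (Q.bind κ).restrict {b | C b = k} := by
    ext A hA
    rw [Measure.restrict_apply hA, Measure.bind_apply hA hκm.aemeasurable,
      Measure.bind_apply (hA.inter hS) hκm.aemeasurable, ← lintegral_indicator hT]
    refine lintegral_congr_ae ((ae_iff_of_countable).2 fun q hq => ?_)
    obtain ⟨-, h⟩ := hκ q hq
    by_cases hqk : c q = k
    · rw [Set.indicator_of_mem (show q ∈ {q | c q = k} from hqk)]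
      refine measure_congr ?_
      filter_upwards [h] with b hb
      exact propext ⟨fun hA => ⟨hA, hb.trans hqk⟩, fun hA => hA.1⟩
    · rw [Set.indicator_of_notMem (show q ∉ {q | c q = k} from hqk)]
      have hnull : κ q {b | ¬ C b = c q} = 0 := h
      exact (measure_mono_null (fun b hb (hb' : C b = c q) => hqk (hb'.symm.trans hb.2)) hnull).symm
  have hmass : (Q.bind κ) {b | C b = k} = Q {q | c q = k} := by
    rw [← Measure.restrict_apply_univ, ← hrestrict, Measure.bind_apply MeasurableSet.univ
      hκm.aemeasurable, ← Measure.restrict_apply_univ (μ := Q), ← lintegral_one]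
    refine lintegral_congr_ae ((ae_iff_of_countable).2 fun q hq => (hκ q fun h0 => hq ?_).1)
    exact Measure.restrict_le_self.absolutelyContinuous h0
  refine ⟨hmass, ?_⟩
  rw [ProbabilityTheory.cond, ProbabilityTheory.cond, hmass, ← hrestrict]
  ext A hA
  rw [Measure.bind_apply hA hκm.aemeasurable, lintegral_smul_measure, Measure.smul_apply,
    Measure.bind_apply hA hκm.aemeasurable]

variable {Ω : Type*} [MeasurableSpace Ω] {p : ℕ}

/-- The law of independent Bernoulli variables and an independent Poisson variable. -/
def countsLaw (lam : Fin p → unitInterval) (r : ℝ≥0) : Measure ((Fin p → Bool) × ℕ) :=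
  (Measure.pi fun i => bernoulliMeasure true false (lam i)).prod (poissonMeasure r)

lemma countsLaw_singleton (lam : Fin p → unitInterval) (r : ℝ≥0) (ε : Fin p → Bool) (n : ℕ) :
    countsLaw lam r {(ε, n)} =
      ENNReal.ofReal (bernoulliWeight (fun i => (lam i : ℝ)) ε) * poissonMeasure r {n} := by
  have hpi : (Measure.pi fun i => bernoulliMeasure true false (lam i)) {ε} =
      ENNReal.ofReal (bernoulliWeight (fun i => (lam i : ℝ)) ε) := by
    rw [Measure.pi_singleton, bernoulliWeight, ENNReal.ofReal_prod_of_nonneg]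
    · refine Finset.prod_congr rfl fun i _ => ?_
      have h0 := (lam i).2.1
      have h1 := (lam i).2.2
      rw [← ENNReal.ofReal_toReal (measure_ne_top (bernoulliMeasure true false (lam i)) {ε i}),
        ← measureReal_def, bernoulliMeasure_real_apply (lam i) (measurableSet_singleton _)]
      cases h : ε i <;> simp
    · intro i _
      have h0 := (lam i).2.1
      have h1 := (lam i).2.2
      split_ifs
      · exact h0
      · linarith
  rw [countsLaw, ← Set.singleton_prod_singleton, Measure.prod_prod, hpi]

variable {ν : Measure Ω} [IsFiniteMeasure ν] {ψ : Fin p → Ω → ℝ}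

lemma ae_card_iidLaw (ν : Measure Ω) (n : ℕ) : ∀ᵐ s ∂(iidLaw ν n), s.card = n := by
  rw [iidLaw, ae_map_iff measurable_config.aemeasurable (measurableSet_card_eq _)]
  simp

/-- Only for `ν = 0` and `n ≠ 0` does `iidLaw ν n` fail to be a probability measure, and then the
Poisson weight of `n` vanishes. -/
lemma iidLaw_univ {n : ℕ} (h : poissonMeasure (ν Set.univ).toNNReal {n} ≠ 0) :
    iidLaw ν n Set.univ = 1 := by
  rw [iidLaw, Measure.map_apply measurable_config MeasurableSet.univ, Set.preimage_univ]
  obtain rfl | hν := eq_or_ne ν 0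
  · cases n with
    | zero => simp
    | succ n => simp [poissonMeasure_singleton] at h
  · have : NeZero ν := ⟨hν⟩
    exact measure_univ

instance sFinite_iidLaw (n : ℕ) : SFinite (iidLaw ν n) := by
  unfold iidLaw
  infer_instance

/-- The superposition as a mixture over the kept features and the number of Poisson points. -/
lemma bind_countsLaw (hprob : ∀ ε, IsProbabilityMeasure (projectionLaw ν ψ ε))
    (lam : Fin p → unitInterval) :
    (countsLaw lam (ν Set.univ).toNNReal).bind
        (fun q => superposition (projectionLaw ν ψ q.1) (iidLaw ν q.2)) =
      superposition (dppLaw ν ψ fun i => (lam i : ℝ)) (poissonLaw ν) := by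
  ext A hA
  rw [Measure.bind_apply hA (Measurable.of_discrete).aemeasurable, dppLaw, superposition_sum_left,
    poissonLaw_eq_sum_iidLaw, lintegral_countable', ENNReal.tsum_prod', tsum_fintype,
    Measure.finsetSum_apply]
  refine Finset.sum_congr rfl fun ε _ => ?_
  rw [Measure.smul_apply, superposition_sum_right, Measure.sum_apply _ hA, smul_eq_mul,
    ← ENNReal.tsum_mul_left]
  refine tsum_congr fun n => ?_
  rw [countsLaw_singleton, Measure.smul_apply, smul_eq_mul]
  ring

lemma superposition_projectionLaw_iidLaw (hprob : ∀ ε, IsProbabilityMeasure (projectionLaw ν ψ ε))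
    (ε : Fin p → Bool) {n : ℕ} (h : poissonMeasure (ν Set.univ).toNNReal {n} ≠ 0) :
    superposition (projectionLaw ν ψ ε) (iidLaw ν n) Set.univ = 1 ∧
      ∀ᵐ s ∂(superposition (projectionLaw ν ψ ε) (iidLaw ν n)),
        s.card = n + ∑ i, (ε i).toNat := by
  refine ⟨?_, ?_⟩
  · rw [superposition, Measure.map_apply measurable_superposition MeasurableSet.univ,
      Set.preimage_univ, ← Set.univ_prod_univ, Measure.prod_prod, measure_univ, iidLaw_univ h,
      one_mul]
  · rw [superposition, ae_map_iff measurable_superposition.aemeasurable (measurableSet_card_eq _)]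
    have h1 := Measure.quasiMeasurePreserving_fst (μ := projectionLaw ν ψ ε) (ν := iidLaw ν n)
      |>.ae (ae_card_projectionLaw ν ψ ε)
    have h2 := Measure.quasiMeasurePreserving_snd (μ := projectionLaw ν ψ ε) (ν := iidLaw ν n)
      |>.ae (ae_card_iidLaw ν n)
    filter_upwards [h1, h2] with s hs1 hs2
    rw [Multiset.card_add, hs1, hs2, successes, add_comm]

end Conditioning

/-! ### Spectral analysis of the regularized Gramian -/

section Spectral

open Matrix

variable {p : ℕ}

/-- If `A = G^{1/2}`, then `A (G + Λ)⁻¹ A` is the inverse of `1 + A⁻¹ Λ A⁻¹`, so its eigenvalues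
are positive and at most `1`. -/
lemma eigenvalue_mem_Ioc {A Λ P : Matrix (Fin p) (Fin p) ℝ} (hA : A.PosSemidef)
    (hdet : A.det ≠ 0) (hΛ : Λ.PosSemidef) (hP : P ∈ Matrix.orthogonalGroup (Fin p) ℝ)
    {lam : Fin p → ℝ} (hspec : A * (A * A + Λ)⁻¹ * A = P * diagonal lam * Pᵀ) (i : Fin p) :
    0 < lam i ∧ lam i ≤ 1 := by
  have hu : IsUnit A.det := hdet.isUnit
  have hAt : Aᵀ = A := by simpa using hA.isHermitian.eq
  have hPP : Pᵀ * P = 1 := by simpa using (Matrix.mem_orthogonalGroup_iff' (Fin p) ℝ).1 hP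
  set S : Matrix (Fin p) (Fin p) ℝ := A⁻¹ * Λ * A⁻¹ with hS
  have hSpsd : S.PosSemidef := by
    have := hΛ.mul_mul_conjTranspose_same A⁻¹
    rwa [conjTranspose_eq_transpose_of_trivial, transpose_nonsing_inv, hAt] at this
  have hfac : A * A + Λ = A * (1 + S) * A := by
    rw [hS, Matrix.mul_add, Matrix.add_mul, Matrix.mul_one, ← Matrix.mul_assoc, ← Matrix.mul_assoc,
      Matrix.mul_nonsing_inv A hu, Matrix.one_mul, Matrix.mul_assoc Λ, Matrix.nonsing_inv_mul A hu,
      Matrix.mul_one]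
  have hu1 : IsUnit (1 + S).det := (PosDef.one.add_posSemidef hSpsd).det_pos.ne'.isUnit
  have hinv : A * (A * A + Λ)⁻¹ * A = (1 + S)⁻¹ := by
    rw [hfac, Matrix.mul_inv_rev, Matrix.mul_inv_rev, ← Matrix.mul_assoc,
      Matrix.mul_nonsing_inv A hu, Matrix.one_mul, Matrix.mul_assoc, Matrix.nonsing_inv_mul A hu,
      Matrix.mul_one]
  have hone : diagonal lam * (1 + Pᵀ * S * P) = 1 := by
    have h1 : P * diagonal lam * Pᵀ * (1 + S) = 1 := by
      rw [← hspec, hinv, Matrix.nonsing_inv_mul _ hu1]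
    calc diagonal lam * (1 + Pᵀ * S * P)
        = (Pᵀ * P) * diagonal lam * Pᵀ * (1 + S) * P := by
          rw [hPP]
          simp only [Matrix.mul_add, Matrix.add_mul, Matrix.mul_one, Matrix.one_mul,
            Matrix.mul_assoc, hPP]
      _ = Pᵀ * (P * diagonal lam * Pᵀ * (1 + S)) * P := by simp only [Matrix.mul_assoc]
      _ = 1 := by rw [h1, Matrix.mul_one, hPP]
  have hnn : 0 ≤ (Pᵀ * S * P) i i := by
    have := (hSpsd.conjTranspose_mul_mul_same P).diag_nonneg (i := i)
    simpa using this
  have hent : lam i * (1 + (Pᵀ * S * P) i i) = 1 := by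
    have := congrFun (congrFun hone i) i
    simpa [diagonal_mul] using this
  have hpos : 0 < lam i := pos_of_mul_pos_left (by rw [hent]; exact one_pos) (by linarith)
  exact ⟨hpos, by nlinarith⟩

/-- The density of volume sampling, expressed with the orthonormal features. -/
lemma det_add_div_det {n : ℕ} {A Λ P : Matrix (Fin p) (Fin p) ℝ} (hA : A.PosSemidef)
    (hdet : A.det ≠ 0) (hGΛ : (A * A + Λ).det ≠ 0) (hP : P ∈ Matrix.orthogonalGroup (Fin p) ℝ)
    {lam : Fin p → ℝ} (hspec : A * (A * A + Λ)⁻¹ * A = P * diagonal lam * Pᵀ)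
    (Φ : Matrix (Fin n) (Fin p) ℝ) :
    (Φᵀ * Φ + Λ).det / (A * A + Λ).det = (1 - diagonal lam +
      diagonal lam * ((Φ * (A⁻¹ * P))ᵀ * (Φ * (A⁻¹ * P)))).det := by
  have hu : IsUnit A.det := hdet.isUnit
  have hAt : Aᵀ = A := by simpa using hA.isHermitian.eq
  have hPP : Pᵀ * P = 1 := by simpa using (Matrix.mem_orthogonalGroup_iff' (Fin p) ℝ).1 hP
  have hPP' : P * Pᵀ = 1 := by simpa using (Matrix.mem_orthogonalGroup_iff (Fin p) ℝ).1 hP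
  set W := (A * A + Λ)⁻¹ with hW
  have hW1 : W * (A * A + Λ) = 1 := Matrix.nonsing_inv_mul _ hGΛ.isUnit
  have hD : diagonal lam = Pᵀ * (A * W * A) * P := by
    rw [hspec]
    calc diagonal lam = (Pᵀ * P) * diagonal lam * (Pᵀ * P) := by simp [hPP]
      _ = _ := by simp only [Matrix.mul_assoc]
  have hAA : A * A⁻¹ = 1 := Matrix.mul_nonsing_inv A hu
  -- All terms of the right-hand matrix are conjugate, by `A⁻¹ * P`, to products with `W`.
  have hmat : 1 - diagonal lam + diagonal lam * ((Φ * (A⁻¹ * P))ᵀ * (Φ * (A⁻¹ * P))) =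
      Pᵀ * A * W * (Φᵀ * Φ + Λ) * A⁻¹ * P := by
    have h1 : (1 : Matrix (Fin p) (Fin p) ℝ) = Pᵀ * A * (W * (A * A + Λ)) * A⁻¹ * P := by
      rw [hW1, Matrix.mul_one, Matrix.mul_assoc Pᵀ, hAA, Matrix.mul_one, hPP]
    have h2 : diagonal lam = Pᵀ * A * W * (A * A) * A⁻¹ * P := by
      rw [hD]
      simp only [Matrix.mul_assoc]
      rw [← Matrix.mul_assoc A A⁻¹, hAA, Matrix.one_mul]
    have h3 : diagonal lam * ((Φ * (A⁻¹ * P))ᵀ * (Φ * (A⁻¹ * P))) =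
        Pᵀ * A * W * (Φᵀ * Φ) * A⁻¹ * P := by
      rw [hD]
      simp only [Matrix.transpose_mul, transpose_nonsing_inv, hAt, Matrix.mul_assoc]
      rw [← Matrix.mul_assoc P Pᵀ, hPP', Matrix.one_mul, ← Matrix.mul_assoc A A⁻¹, hAA,
        Matrix.one_mul]
    rw [h3, h2]
    nth_rw 1 [h1]
    simp only [Matrix.mul_add, Matrix.add_mul, Matrix.mul_assoc]
    abel
  have hdetW : W.det = ((A * A + Λ).det)⁻¹ := by rw [hW, det_nonsing_inv, Ring.inverse_eq_inv']
  have hdetA : (A⁻¹).det = A.det⁻¹ := by rw [det_nonsing_inv, Ring.inverse_eq_inv']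
  have hdetP : Pᵀ.det * P.det = 1 := by rw [← det_mul, hPP, det_one]
  rw [hmat]
  simp only [det_mul, hdetW, hdetA]
  field_simp
  linear_combination -(Φᵀ * Φ + Λ).det * hdetP

variable {Ω : Type*} [MeasurableSpace Ω] {ν : Measure Ω} {φ : Fin p → Ω → ℝ}

lemma memLp_vecMul (hφ : ∀ i, MemLp (φ i) 2 ν) (C : Matrix (Fin p) (Fin p) ℝ) (i : Fin p) :
    MemLp (fun x => vecMul (fun j => φ j x) C i) 2 ν := by
  have : (fun x => vecMul (fun j => φ j x) C i) = fun x => ∑ j, φ j x * C j i := rfl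
  rw [this]
  exact memLp_finsetSum _ fun j _ => (hφ j).mul_const _

lemma gram_vecMul (hφ : ∀ i, MemLp (φ i) 2 ν) (C : Matrix (Fin p) (Fin p) ℝ) :
    gram ν (fun i x => vecMul (fun j => φ j x) C i) = Cᵀ * gram ν φ * C := by
  have hint : ∀ k l, Integrable (fun x => φ k x * φ l x) ν := fun k l =>
    (hφ k).integrable_mul (hφ l)
  ext i j
  have hx : ∀ x, vecMul (fun j => φ j x) C i * vecMul (fun j => φ j x) C j =
      ∑ l, ∑ k, C k i * C l j * (φ k x * φ l x) := by
    intro x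
    simp only [vecMul, dotProduct]
    rw [Finset.sum_mul_sum, Finset.sum_comm]
    exact Finset.sum_congr rfl fun l _ => Finset.sum_congr rfl fun k _ => by ring
  simp only [gram, of_apply, hx]
  rw [integral_finsetSum _ fun l _ => integrable_finsetSum _ fun k _ => (hint k l).const_mul _]
  simp_rw [integral_finsetSum _ fun k _ => (hint k _).const_mul _, integral_const_mul]
  simp only [Matrix.mul_apply, transpose_apply, of_apply, Finset.sum_mul]
  exact Finset.sum_congr rfl fun l _ => Finset.sum_congr rfl fun k _ => by ring

lemma gram_posSemidef (hφ : ∀ i, MemLp (φ i) 2 ν) : (gram ν φ).PosSemidef := by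
  refine PosSemidef.of_dotProduct_mulVec_nonneg ?_ fun v => ?_
  · ext i j
    simp [gram, mul_comm]
  · have hint : ∀ k l, Integrable (fun x => φ k x * φ l x) ν := fun k l =>
      (hφ k).integrable_mul (hφ l)
    have hsq : star v ⬝ᵥ (gram ν φ *ᵥ v) = ∫ x, (∑ i, v i * φ i x) * ∑ j, v j * φ j x ∂ν := by
      have hx : ∀ x, (∑ i, v i * φ i x) * ∑ j, v j * φ j x =
          ∑ i, ∑ j, v i * v j * (φ i x * φ j x) := by
        intro x
        rw [Finset.sum_mul_sum]
        exact Finset.sum_congr rfl fun l _ => Finset.sum_congr rfl fun k _ => by ring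
      simp only [hx]
      rw [integral_finsetSum _ fun l _ => integrable_finsetSum _ fun k _ =>
        (hint l k).const_mul _]
      simp_rw [integral_finsetSum _ fun k _ => (hint _ k).const_mul _, integral_const_mul]
      simp only [dotProduct, mulVec, gram, of_apply, Finset.mul_sum, star_trivial]
      exact Finset.sum_congr rfl fun l _ => Finset.sum_congr rfl fun k _ => by ring
    rw [hsq]
    exact integral_nonneg fun x => mul_self_nonneg _

lemma gramSqrt_posSemidef (ν : Measure Ω) (φ : Fin p → Ω → ℝ) : (gramSqrt ν φ).PosSemidef :=
  Matrix.nonneg_iff_posSemidef.1 (CFC.sqrt_nonneg _)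

lemma gramSqrt_mul_self (hφ : ∀ i, MemLp (φ i) 2 ν) : gramSqrt ν φ * gramSqrt ν φ = gram ν φ :=
  CFC.sqrt_mul_sqrt_self _ (Matrix.nonneg_iff_posSemidef.2 (gram_posSemidef hφ))

lemma det_gramSqrt_ne_zero (hφ : ∀ i, MemLp (φ i) 2 ν) (hG : (gram ν φ).det ≠ 0) :
    (gramSqrt ν φ).det ≠ 0 := by
  rw [← gramSqrt_mul_self hφ, det_mul] at hG
  exact left_ne_zero_of_mul hG

lemma memLp_orthoFeatures (hφ : ∀ i, MemLp (φ i) 2 ν) (P : Matrix (Fin p) (Fin p) ℝ) (i : Fin p) :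
    MemLp (orthoFeatures ν φ P i) 2 ν :=
  memLp_vecMul hφ _ i

lemma integral_orthoFeatures_mul (hφ : ∀ i, MemLp (φ i) 2 ν) (hG : (gram ν φ).det ≠ 0)
    {P : Matrix (Fin p) (Fin p) ℝ} (hP : P ∈ Matrix.orthogonalGroup (Fin p) ℝ) (i j : Fin p) :
    ∫ x, orthoFeatures ν φ P i x * orthoFeatures ν φ P j x ∂ν = if i = j then 1 else 0 := by
  have hu : IsUnit (gramSqrt ν φ).det := (det_gramSqrt_ne_zero hφ hG).isUnit
  have hAt : (gramSqrt ν φ)ᵀ = gramSqrt ν φ := by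
    simpa using (gramSqrt_posSemidef ν φ).isHermitian.eq
  have hPP : Pᵀ * P = 1 := by simpa using (Matrix.mem_orthogonalGroup_iff' (Fin p) ℝ).1 hP
  have h := gram_vecMul hφ ((gramSqrt ν φ)⁻¹ * P)
  have h1 : ((gramSqrt ν φ)⁻¹ * P)ᵀ * gram ν φ * ((gramSqrt ν φ)⁻¹ * P) = 1 := by
    rw [← gramSqrt_mul_self hφ, Matrix.transpose_mul, transpose_nonsing_inv, hAt]
    simp only [Matrix.mul_assoc]
    rw [← Matrix.mul_assoc (gramSqrt ν φ) (gramSqrt ν φ)⁻¹, Matrix.mul_nonsing_inv _ hu,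
      Matrix.one_mul, ← Matrix.mul_assoc (gramSqrt ν φ)⁻¹ (gramSqrt ν φ),
      Matrix.nonsing_inv_mul _ hu, Matrix.one_mul, hPP]
  rw [h1] at h
  have := congrFun (congrFun h i) j
  rwa [Matrix.one_apply] at this

lemma design_orthoFeatures (P : Matrix (Fin p) (Fin p) ℝ) {n : ℕ} (x : Fin n → Ω) :
    design (orthoFeatures ν φ P) x = design φ x * ((gramSqrt ν φ)⁻¹ * P) := rfl

lemma measurable_orthoFeatures (hφ : ∀ i, Measurable (φ i)) (P : Matrix (Fin p) (Fin p) ℝ)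
    (i : Fin p) : Measurable (orthoFeatures ν φ P i) := by
  unfold orthoFeatures vecMul dotProduct
  fun_prop

/-- Volume sampling is the superposition of a determinantal and a Poisson process. -/
lemma pvs_eq_superposition [IsFiniteMeasure ν] (hφm : ∀ i, Measurable (φ i))
    (hφ : ∀ i, MemLp (φ i) 2 ν) (hG : (gram ν φ).det ≠ 0) {Λ : Matrix (Fin p) (Fin p) ℝ}
    (hΛ : Λ.PosSemidef) {P : Matrix (Fin p) (Fin p) ℝ}
    (hP : P ∈ Matrix.orthogonalGroup (Fin p) ℝ) {lam : Fin p → ℝ}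
    (hspec : gramSqrt ν φ * (gram ν φ + Λ)⁻¹ * gramSqrt ν φ = P * diagonal lam * Pᵀ) :
    pvs ν φ Λ = superposition (dppLaw ν (orthoFeatures ν φ P) lam) (poissonLaw ν) := by
  have hA := gramSqrt_posSemidef ν φ
  have hdet := det_gramSqrt_ne_zero hφ hG
  have hGΛ : (gram ν φ + Λ).det ≠ 0 :=
    (((gram_posSemidef hφ).posDef_iff_isUnit.2 (by
      rw [Matrix.isUnit_iff_isUnit_det]; exact hG.isUnit)).add_posSemidef hΛ).det_pos.ne'
  rw [← gramSqrt_mul_self hφ] at hspec hGΛ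
  refine janossyLaw_eq_superposition (measurable_orthoFeatures hφm P) (fun i => ?_) fun n x => ?_
  · have := eigenvalue_mem_Ioc hA hdet hΛ hP hspec i
    exact ⟨this.1.le, this.2⟩
  · rw [design_orthoFeatures, ← det_add_div_det hA hdet hGΛ hP hspec, gramSqrt_mul_self hφ,
      Real.exp_neg]
    field_simp

end Spectral

/-! ### Almost everywhere modifications of the features -/

section Congruence

variable {p : ℕ} {Ω : Type*} [MeasurableSpace Ω] {ν : Measure Ω}
  {φ φ' : Fin p → Ω → ℝ}

lemma gram_congr (h : ∀ i, φ i =ᵐ[ν] φ' i) : gram ν φ = gram ν φ' := by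
  ext i j
  refine integral_congr_ae ?_
  filter_upwards [h i, h j] with x hi hj
  rw [hi, hj]

lemma orthoFeatures_congr (h : ∀ i, φ i =ᵐ[ν] φ' i) (P : Matrix (Fin p) (Fin p) ℝ) (i : Fin p) :
    orthoFeatures ν φ P i =ᵐ[ν] orthoFeatures ν φ' P i := by
  filter_upwards [ae_all_iff.2 h] with x hx
  rw [orthoFeatures, orthoFeatures, gramSqrt, gramSqrt, gram_congr h, funext hx]

variable [IsFiniteMeasure ν]

lemma ae_pi_eq (h : ∀ i, φ i =ᵐ[ν] φ' i) (n : ℕ) :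
    ∀ᵐ x ∂(Measure.pi fun _ : Fin n => ν), ∀ i j, φ j (x i) = φ' j (x i) := by
  refine ae_all_iff.2 fun i => ae_all_iff.2 fun j => ?_
  exact (Measure.quasiMeasurePreserving_eval (fun _ : Fin n => ν) i).ae (h j)

lemma pvs_congr (h : ∀ i, φ i =ᵐ[ν] φ' i) (Λ : Matrix (Fin p) (Fin p) ℝ) :
    pvs ν φ Λ = pvs ν φ' Λ := by
  rw [pvs, pvs, janossyLaw, janossyLaw, gram_congr h]
  refine congrArg _ (funext fun n => ?_)
  congr 2
  refine withDensity_congr_ae ?_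
  filter_upwards [ae_pi_eq h n] with x hx
  have : design φ x = design φ' x := by
    ext i j
    exact hx i j
  rw [this]

lemma isDPP_congr {ψ ψ' : Fin p → Ω → ℝ} (h : ∀ i, ψ i =ᵐ[ν] ψ' i) (w : Fin p → ℝ)
    {μ : Measure (Multiset Ω)} (hμ : IsDPP ν (spectralKernel w ψ) μ) :
    IsDPP ν (spectralKernel w ψ') μ where
  isProbabilityMeasure := hμ.isProbabilityMeasure
  correlation := by
    intro n f hf
    rw [hμ.correlation n f hf]
    refine lintegral_congr_ae ?_
    filter_upwards [ae_pi_eq h n] with x hx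
    simp only [spectralKernel, hx]

end Congruence

end PVS

end

theorem proposition6 {Ω : Type*} [TopologicalSpace Ω] [PolishSpace Ω] [MeasurableSpace Ω]
    [BorelSpace Ω] (ν : Measure Ω) [IsFiniteMeasure ν] {p : ℕ} (φ : Fin p → Ω → ℝ)
    (hφ : ∀ i, MemLp (φ i) 2 ν) (hG : (PVS.gram ν φ).det ≠ 0)
    (Λ : Matrix (Fin p) (Fin p) ℝ) (hΛ : Λ.PosSemidef)
    (P : Matrix (Fin p) (Fin p) ℝ) (hP : P ∈ Matrix.orthogonalGroup (Fin p) ℝ)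
    (lam : Fin p → ℝ)
    (hspec : PVS.gramSqrt ν φ * (PVS.gram ν φ + Λ)⁻¹ * PVS.gramSqrt ν φ =
      P * Matrix.diagonal lam * Pᵀ)
    (ψ : Fin p → Ω → ℝ) (hψ : ψ = PVS.orthoFeatures ν φ P)
    {S : Type*} [MeasurableSpace S] (Pr : Measure S) [IsProbabilityMeasure Pr] :
    -- the eigenvalues lie in `[0, 1]`
    ∃ hlam : ∀ i, lam i ∈ unitInterval,
    -- the functions `ψ i` are orthonormal in `L²(ν)`
    ((∀ i, MemLp (ψ i) 2 ν) ∧ ∀ i j, ∫ x, ψ i x * ψ j x ∂ν = if i = j then 1 else 0) ∧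
    -- the determinantal processes below are well defined
    (∀ w : Fin p → ℝ, (∀ i, w i ∈ unitInterval) →
      ∃! μ : Measure (Multiset Ω), PVS.IsDPP ν (PVS.spectralKernel w ψ) μ) ∧
    -- superposition
    (∀ X Y : S → Multiset Ω, Measurable X → Measurable Y →
      PVS.IsDPP ν (PVS.spectralKernel lam ψ) (Pr.map X) →
      PVS.IsPoissonProcess ν (Pr.map Y) → IndepFun X Y Pr →
      Pr.map (fun s => X s + Y s) = PVS.pvs ν φ Λ) ∧
    -- for `k ≥ p` the event of having `k` points can be conditioned upon
    (∀ k : ℕ, p ≤ k → ν ≠ 0 → PVS.pvs ν φ Λ {s | s.card = k} ≠ 0) ∧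
    -- the sampler with prescribed cardinality
    (∀ D : (Fin p → Bool) → Measure (Multiset Ω),
      (∀ ε, PVS.IsDPP ν (PVS.spectralKernel (fun i => ((ε i).toNat : ℝ)) ψ) (D ε)) →
      ∀ k : ℕ, PVS.pvs ν φ Λ {s | s.card = k} ≠ 0 →
        PVS.conditionedSampler ν (fun i => ⟨lam i, hlam i⟩) D k =
          (PVS.pvs ν φ Λ)[|{s | s.card = k}]) := by
  -- All the laws only depend on the almost everywhere classes of the features, so these may be
  -- assumed measurable.
  obtain ⟨φ', hφ'm, hφ'⟩ : ∃ φ' : Fin p → Ω → ℝ, (∀ i, Measurable (φ' i)) ∧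
      ∀ i, φ i =ᵐ[ν] φ' i :=
    ⟨fun i => (hφ i).1.aemeasurable.mk (φ i), fun i => (hφ i).1.aemeasurable.measurable_mk,
      fun i => (hφ i).1.aemeasurable.ae_eq_mk⟩
  have hφL : ∀ i, MemLp (φ' i) 2 ν := fun i => (hφ i).ae_eq (hφ' i)
  have hsqrt : PVS.gramSqrt ν φ = PVS.gramSqrt ν φ' := by
    rw [PVS.gramSqrt, PVS.gramSqrt, PVS.gram_congr hφ']
  have hψ0m : ∀ i, MemLp (ψ i) 2 ν := hψ ▸ PVS.memLp_orthoFeatures hφ P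
  have hψ0o : ∀ i j, ∫ x, ψ i x * ψ j x ∂ν = if i = j then 1 else 0 :=
    hψ ▸ PVS.integral_orthoFeatures_mul hφ hG hP
  set ψ' := PVS.orthoFeatures ν φ' P with hψ'
  have hψψ' : ∀ i, ψ i =ᵐ[ν] ψ' i := hψ ▸ PVS.orthoFeatures_congr hφ' P
  rw [hsqrt, PVS.gram_congr hφ'] at hspec
  rw [PVS.gram_congr hφ'] at hG
  have hpvs : PVS.pvs ν φ Λ = PVS.superposition (PVS.dppLaw ν ψ' lam) (PVS.poissonLaw ν) := by
    rw [PVS.pvs_congr hφ', PVS.pvs_eq_superposition hφ'm hφL hG hΛ hP hspec]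
  have hm : ∀ i, Measurable (ψ' i) := PVS.measurable_orthoFeatures hφ'm P
  have hL : ∀ i, MemLp (ψ' i) 2 ν := PVS.memLp_orthoFeatures hφL P
  have ho := PVS.integral_orthoFeatures_mul hφL hG hP
  have hpos : ∀ i, 0 < lam i ∧ lam i ≤ 1 := by
    rw [← PVS.gramSqrt_mul_self hφL] at hspec
    exact PVS.eigenvalue_mem_Ioc (PVS.gramSqrt_posSemidef ν φ') (PVS.det_gramSqrt_ne_zero hφL hG)
      hΛ hP hspec
  have hlam : ∀ i, lam i ∈ unitInterval := fun i => ⟨(hpos i).1.le, (hpos i).2⟩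
  have hdpp : ∀ {w : Fin p → ℝ} {μ : Measure (Multiset Ω)}, (∀ i, w i ∈ unitInterval) →
      PVS.IsDPP ν (PVS.spectralKernel w ψ) μ → μ = PVS.dppLaw ν ψ' w := fun hw hμ =>
    PVS.eq_dppLaw_of_isDPP hm hL ho hw (PVS.isDPP_congr hψψ' _ hμ)
  have hprob := PVS.isProbabilityMeasure_projectionLaw hm hL ho
  have hbind := PVS.bind_countsLaw hprob fun i => (⟨lam i, hlam i⟩ : unitInterval)
  rw [← hpvs] at hbind
  have hcond := PVS.bind_cond
    (PVS.countsLaw (fun i => (⟨lam i, hlam i⟩ : unitInterval)) (ν Set.univ).toNNReal)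
    (fun q => PVS.superposition (PVS.projectionLaw ν ψ' q.1) (PVS.iidLaw ν q.2))
    (fun q => q.2 + ∑ i, (q.1 i).toNat) PVS.measurable_card (fun q hq =>
      PVS.superposition_projectionLaw_iidLaw hprob q.1 fun h0 => hq (by
        rw [← Prod.mk.eta (p := q), PVS.countsLaw_singleton, h0, mul_zero]))
  rw [hbind] at hcond
  refine ⟨hlam, ⟨hψ0m, hψ0o⟩, fun w hw => ?_, fun X Y hX hY hXd hYp hXY => ?_,
    fun k hk hν => ?_, fun D hD k _ => ?_⟩
  · exact ⟨PVS.dppLaw ν ψ' w, PVS.isDPP_congr (fun i => (hψψ' i).symm) w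
      (PVS.isDPP_dppLaw hm hL ho hw), fun μ hμ => hdpp hw hμ⟩
  · rw [hpvs, ← hdpp hlam hXd, ← PVS.eq_poissonLaw_of_isPoissonProcess hYp, PVS.superposition,
      ← (indepFun_iff_map_prod_eq_prod_map_map hX.aemeasurable hY.aemeasurable).1 hXY,
      Measure.map_map PVS.measurable_superposition (hX.prodMk hY)]
    rfl
  · -- All the features are kept with positive probability, since the eigenvalues are positive.
    rw [(hcond k).1]
    have hmem : {((fun _ => true : Fin p → Bool), k - p)} ⊆
        {q : (Fin p → Bool) × ℕ | q.2 + ∑ i, (q.1 i).toNat = k} := by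
      rw [Set.singleton_subset_iff]
      simpa using Nat.sub_add_cancel hk
    refine fun h0 => absurd (measure_mono_null hmem h0) ?_
    rw [PVS.countsLaw_singleton]
    refine mul_ne_zero ?_ ?_
    · rw [Ne, ENNReal.ofReal_eq_zero, not_le]
      exact Finset.prod_pos fun i _ => by simpa using (hpos i).1
    · rw [poissonMeasure_singleton, Ne, ENNReal.ofReal_eq_zero, not_le]
      have : 0 < (ν Set.univ).toNNReal := by
        simpa [pos_iff_ne_zero, ENNReal.toNNReal_eq_zero_iff] using hν
      positivity
  · have hDε : ∀ ε, D ε = PVS.projectionLaw ν ψ' ε := fun ε =>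
      (hdpp (w := PVS.indicatorVec ε) (fun i => by
        cases h : ε i <;> simp [PVS.indicatorVec, h]) (hD ε)).trans
        (PVS.dppLaw_indicatorVec ν ψ' ε)
    rw [← (hcond k).2]
    simp only [PVS.conditionedSampler, hDε]
    rfl
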